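/- Let $\mathcal X\subseteq\mathbb R^d$, let $T\subseteq\{1,\dots,d\}$, and for $x\in\mathbb R^d$ let $x^T\in\mathbb R^d$ be the vector with $x^T_i=x_i$ for $i\in T$ and $x^T_i=0$ otherwise; suppose that $x^T\in\mathcal X$ for all $x\in\mathcal X$. Let $\mathcal Y$ be a measurable space. Let $(H_1,k_1)$ and $(H_2,k_2)$ be reproducing kernel Hilbert spaces of real functions on $\mathcal X$ and $\mathcal Y$ with measurable kernels. For $u\in\mathbb R^T$ let $\bar u\in\mathbb R^d$ be its extension by zero, let $\mathcal X_T=\{u\in\mathbb R^T:\bar u\in\mathcal X\}$, and let $(\tilde H_1,\tilde k_1)$ be the reproducing kernel Hilbert space on $\mathcal X_T$ with kernel $\tilde k_1(u,v)=k_1(\bar u,\bar v)$. Let $(X,Y)$ be a random vector in $\mathcal X\times\mathcal Y$, let $X_T=(X_i)_{i\in T}$, and assume that $\mathbb E[k_1(X,X)]$, $\mathbb E[\tilde k_1(X_T,X_T)]$ and $\mathbb E[k_2(Y,Y)]$ are finite. A reproducing kernel Hilbert space $(H,k)$ is called characteristic if the map $P\mapsto\mathbb E_{Z\sim P}[k(Z,\cdot)]\in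 H$ is one-to-one on the probability measures $P$ with $\mathbb E_{Z\sim P}[\sqrt{k(Z,Z)}]<\infty$. For random elements $Z,W$ and reproducing kernel Hilbert spaces $H_Z,H_W$ with kernels $k_Z,k_W$ on their ranges such that $\mathbb E[k_Z(Z,Z)]$ and $\mathbb E[k_W(W,W)]$ are finite, let $\Sigma_{WZ}:H_Z\to H_W$ be the bounded operator with $\langle g,\Sigma_{WZ}f\rangle=\mathrm{Cov}(f(Z),g(W))$ for all $f\in H_Z$, $g\in H_W$. Let $V_{WZ}:H_Z\to H_W$ be the unique bounded operator with $\Sigma_{WZ}=\Sigma_{WW}^{1/2}V_{WZ}\Sigma_{ZZ}^{1/2}$ that vanishes on $\ker\Sigma_{ZZ}$ and takes its values in $\overline{\mathrm{ran}\,\Sigma_{WW}}$. The conditional covariance operator is $\Sigma_{WW|Z}=\Sigma_{WW}-\Sigma_{WW}^{1/2}V_{WZ}V_{ZW}\Sigma_{WW}^{1/2}$. Let $\Sigma_{YY|X}$ be formed with $H_1,H_2$, and $\Sigma_{YY|X_T}$ with $\tilde H_1,H_2$. If $(H_1,k_1)$ and $(H_2,k_2)$ are characteristic, then $\Sigma_{YY|X}\le\Sigma_{YY|X_T}$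 in the partial order on self-adjoint operators on $H_2$, that is, $\langle g,\Sigma_{YY|X}\,g\rangle\le\langle g,\Sigma_{YY|X_T}\,g\rangle$ for all $g\in H_2$. Moreover, $\Sigma_{YY|X}=\Sigma_{YY|X_T}$ if and only if $Y$ and $X$ are conditionally independent given $X_T$. -/

import Mathlib

open MeasureTheory ProbabilityTheory

noncomputable section

namespace CondCovOp

section Kernels

variable {α : Type*} (H : Type*) [NormedAddCommGroup H] [InnerProductSpace ℝ H]
  [CompleteSpace H] [RKHS ℝ H α ℝ]

/-- The real-valued reproducing kernel `k (x, y)` of a reproducing kernel Hilbert space of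
real functions (Mathlib's kernel takes values in the operators on `ℝ`). -/
def ker (x y : α) : ℝ := RKHS.kernel H x y 1

/-- `(H, k)` is characteristic: the map `P ↦ E_P[k (X, ·)]` is one-to-one on the probability
measures `P` that have a mean embedding, `E_P[√(k (X, X))] < ∞` (for a bounded measurable kernel,
on all of them). The elements `E_P[k (X, ·)]` of `H` are compared as functions. -/
def IsCharacteristic [MeasurableSpace α] : Prop :=
  ∀ P Q : Measure α, IsProbabilityMeasure P → IsProbabilityMeasure Q →
    Integrable (fun x => √(ker H x x)) P → Integrable (fun x => √(ker H x x)) Q →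
    (∀ y, ∫ x, ker H x y ∂P = ∫ x, ker H x y ∂Q) → P = Q

end Kernels

section Operators

variable {Ω : Type*} [MeasurableSpace Ω] {α β : Type*}
  (H : Type*) [NormedAddCommGroup H] [InnerProductSpace ℝ H] [RKHS ℝ H α ℝ]
  (K : Type*) [NormedAddCommGroup K] [InnerProductSpace ℝ K] [RKHS ℝ K β ℝ]

/-- The cross-covariance operator `Σ_YX : H → K` of `(X, Y)`: the (unique) bounded operator with
`⟪g, Σ_YX f⟫ = Cov (f (X), g (Y))`. -/
def crossCov (μ : Measure Ω) (X : Ω → α) (Y : Ω → β) : H →L[ℝ] K :=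
  Classical.epsilon fun A : H →L[ℝ] K =>
    ∀ (f : H) (g : K), inner ℝ g (A f) = cov[fun ω => f (X ω), fun ω => g (Y ω); μ]

variable {H} in
/-- The square root `A^{1/2}` of a positive operator: the (unique) positive operator `S` with
`S ∘ S = A`. -/
def opSqrt (A : H →L[ℝ] H) : H →L[ℝ] H :=
  Classical.epsilon fun S : H →L[ℝ] H => S.IsPositive ∧ S ∘L S = A

/-- The operator `V_YX : H → K`: the (unique) bounded operator with
`Σ_YX = Σ_YY^{1/2} V_YX Σ_XX^{1/2}` that vanishes on the kernel of `Σ_XX` and takes its values in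
the closure of the range of `Σ_YY` (the normalization without which `V_YX` is not unique). -/
def corrOp (μ : Measure Ω) (X : Ω → α) (Y : Ω → β) : H →L[ℝ] K :=
  Classical.epsilon fun V : H →L[ℝ] K =>
    crossCov H K μ X Y = opSqrt (crossCov K K μ Y Y) ∘L V ∘L opSqrt (crossCov H H μ X X) ∧
    (∀ f : H, crossCov H H μ X X f = 0 → V f = 0) ∧
    (∀ f : H, V f ∈ closure (Set.range (crossCov K K μ Y Y)))

/-- The conditional covariance operator
`Σ_YY|X = Σ_YY - Σ_YY^{1/2} V_YX V_XY Σ_YY^{1/2}` on `K`. -/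
def condCov (μ : Measure Ω) (X : Ω → α) (Y : Ω → β) : K →L[ℝ] K :=
  crossCov K K μ Y Y -
    opSqrt (crossCov K K μ Y Y) ∘L corrOp H K μ X Y ∘L corrOp K H μ Y X ∘L
      opSqrt (crossCov K K μ Y Y)

end Operators

section Independence

variable {Ω : Type*} [MeasurableSpace Ω] {α β γ : Type*} [MeasurableSpace α] [MeasurableSpace β]
  [mγ : MeasurableSpace γ]

/-- `Y` and `X` are conditionally independent given (the σ-algebra generated by) `Z`.
Mathlib's `CondIndepFun` asks for a standard Borel `Ω`, and is equivalent to this there. -/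
def CondIndepGiven (μ : Measure Ω) (Y : Ω → β) (X : Ω → α) (Z : Ω → γ) : Prop :=
  ∀ (B : Set β) (A : Set α), MeasurableSet B → MeasurableSet A →
    (μ⟦Y ⁻¹' B ∩ X ⁻¹' A | mγ.comap Z⟧) =ᵐ[μ]
      (μ⟦Y ⁻¹' B | mγ.comap Z⟧) * (μ⟦X ⁻¹' A | mγ.comap Z⟧)

end Independence

section Features

variable {d : ℕ} (T : Finset (Fin d))

/-- Extension by zero `ℝ^T → ℝ^d`. -/
def zeroExt (u : T → ℝ) : Fin d → ℝ := fun i => if h : i ∈ T then u ⟨i, h⟩ else 0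

/-- `x^T ∈ ℝ^d`: the coordinates of `x` in `T`, and `0` elsewhere. -/
def mask (x : Fin d → ℝ) : Fin d → ℝ := fun i => if i ∈ T then x i else 0

/-- Masking is restriction to `T` followed by extension by zero. -/
theorem zeroExt_restrict (x : Fin d → ℝ) : zeroExt T (T.restrict x) = mask T x := by
  funext i
  by_cases h : i ∈ T <;> simp [zeroExt, mask, h]

/-- The domain in `ℝ^T` of the reduced kernel: the points whose extension by zero is in `𝒳`
(the projection of `𝒳` to `ℝ^T`, when `𝒳` is closed under `x ↦ x^T`). -/
def subDomain (𝒳 : Set (Fin d → ℝ)) : Set (T → ℝ) := {u | zeroExt T u ∈ 𝒳}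

variable {T}

/-- Extension by zero, as a map between the domains. -/
def embed {𝒳 : Set (Fin d → ℝ)} (u : subDomain T 𝒳) : 𝒳 := ⟨zeroExt T u, u.2⟩

/-- The point `x_T ∈ ℝ^T` of the selected coordinates of `x ∈ 𝒳`. -/
def select {𝒳 : Set (Fin d → ℝ)} (h𝒳 : ∀ x ∈ 𝒳, mask T x ∈ 𝒳) (x : 𝒳) : subDomain T 𝒳 :=
  ⟨T.restrict (x : Fin d → ℝ), by
    rw [subDomain, Set.mem_ofPred_eq, zeroExt_restrict]; exact h𝒳 x x.2⟩

end Features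

end CondCovOp

end

/-!
# Conditional covariance operators and conditional independence

Write `J_X f = f (X) - E [f (X)]`, a bounded operator from the reproducing kernel Hilbert space of
`X` to `L²(μ)` (`exists_isCenteredEmbedding`). Every cross-covariance operator factors through
these embeddings, `Σ_YX = J_Y† J_X` (`crossCov_eq`). The square root `S_X` of `Σ_XX = J_X† J_X`
satisfies `‖S_X f‖ = ‖J_X f‖`, so `J_X = U_X S_X` for a partial isometry `U_X` (`exists_polar`);
the normalized `V_YX` is `U_Y† U_X` (`corrOp_eq`), and since `U_X U_X†` is the orthogonal
projection `P_X` onto the closed range of `J_X`, `Σ_YY|X = J_Y† (1 - P_X) J_Y` (`condCov_eq`).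

For a characteristic kernel the closed range of `J_X` consists of all centered `σ(X)`-measurable
functions in `L²` (`IsCharacteristic.mem_closure_range_iff`): if a centered `h ∈ L²` is orthogonal
to all `f (X)`, then the normalized positive and negative parts of `h` are densities under which
`X` has the same mean embedding, hence the same law, so `h` integrates to `0` over every event of
`σ(X)`. The kernel on the selected coordinates inherits the property
(`IsCharacteristic.of_leftInverse`). As `σ(X_T) ⊆ σ(X)`, the projections are nested, which gives
the inequality. Equality of the two operators means that `P_X` and `P_{X_T}` agree on all `g (Y) -
E [g (Y)]`, that is, `E [g (Y) | X] = E [g (Y) | X_T]` for all `g`; because the `g (Y)` determine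
`σ(Y)`, this is conditional independence (`condIndepGiven_of_starProjection_eq`,
`starProjection_eq_of_condIndepGiven`).

The existence of `S_X` on a real Hilbert space is proved with the power series of `√(1 - b)`,
whose coefficients are, up to sign and powers of `2`, Catalan numbers (`exists_isPositive_sqrt`).
-/

noncomputable section

namespace CondCovOp

/-! ### Positive square roots on real Hilbert spaces -/

section SquareRoot

/-- With `b n = centralBinom n / 4 ^ n`, the `n`-th term is `2 * (b n - b (n + 1))`, so the partial
sums telescope. -/
theorem sum_catalan_div_four_pow_le (N : ℕ) :
    ∑ n ∈ Finset.range N, (catalan n : ℝ) / 4 ^ n ≤ 2 := by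
  have hterm (n : ℕ) : (catalan n : ℝ) / 4 ^ n =
      2 * (n.centralBinom / 4 ^ n) - 2 * ((n + 1).centralBinom / 4 ^ (n + 1)) := by
    have h1 : ((n : ℝ) + 1) * catalan n = n.centralBinom := by
      exact_mod_cast succ_mul_catalan_eq_centralBinom n
    have h2 : ((n : ℝ) + 1) * (n + 1).centralBinom = 2 * (2 * n + 1) * n.centralBinom := by
      exact_mod_cast Nat.succ_mul_centralBinom_succ n
    have hn : (n : ℝ) + 1 ≠ 0 := by positivity
    have h1' := eq_div_of_mul_eq hn ((mul_comm _ _).trans h1)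
    have h2' := eq_div_of_mul_eq hn ((mul_comm _ _).trans h2)
    rw [h1', h2', pow_succ]
    field_simp
    ring
  simp_rw [hterm]
  rw [Finset.sum_range_sub' (fun n : ℕ => 2 * ((n.centralBinom : ℝ) / 4 ^ n))]
  have : (0 : ℝ) ≤ 2 * ((N.centralBinom : ℝ) / 4 ^ N) := by positivity
  simpa using this

theorem summable_catalan_div_four_pow : Summable fun n => (catalan n : ℝ) / 4 ^ n :=
  summable_of_sum_range_le (fun _ => by positivity) sum_catalan_div_four_pow_le

theorem tsum_catalan_div_four_pow_le : ∑' n, (catalan n : ℝ) / 4 ^ n ≤ 2 :=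
  Real.tsum_le_of_sum_range_le (fun _ => by positivity) sum_catalan_div_four_pow_le

/-- The value at `b / 4` of the generating function `C` of the Catalan numbers. -/
def catalanSeries {R : Type*} [NormedRing R] [NormedAlgebra ℝ R] (b : R) : R :=
  ∑' n, ((catalan n : ℝ) / 4 ^ n) • b ^ n

section Ring

variable {R : Type*} [NormedRing R] [NormOneClass R] [NormedAlgebra ℝ R] {b : R}

theorem norm_catalan_smul_pow_le (hb : ‖b‖ ≤ 1) (n : ℕ) :
    ‖((catalan n : ℝ) / 4 ^ n) • b ^ n‖ ≤ (catalan n : ℝ) / 4 ^ n := by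
  rw [norm_smul, Real.norm_of_nonneg (by positivity)]
  exact mul_le_of_le_one_right (by positivity)
    ((norm_pow_le b n).trans (pow_le_one₀ (norm_nonneg b) hb))

theorem summable_norm_catalan (hb : ‖b‖ ≤ 1) :
    Summable fun n => ‖((catalan n : ℝ) / 4 ^ n) • b ^ n‖ :=
  .of_nonneg_of_le (fun _ => norm_nonneg _) (norm_catalan_smul_pow_le hb)
    summable_catalan_div_four_pow

theorem norm_catalanSeries_le (hb : ‖b‖ ≤ 1) : ‖catalanSeries b‖ ≤ 2 :=
  (tsum_of_norm_bounded summable_catalan_div_four_pow.hasSum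
    (norm_catalan_smul_pow_le hb)).trans tsum_catalan_div_four_pow_le

omit [NormOneClass R] in
theorem commute_catalanSeries : Commute b (catalanSeries b) :=
  Commute.tsum_right _ fun n => ((Commute.refl b).pow_right n).smul_right _

/-- The quadratic equation `C(x) = 1 + x C(x)²` at `x = b / 4`. -/
theorem catalanSeries_eq [CompleteSpace R] (hb : ‖b‖ ≤ 1) :
    catalanSeries b = 1 + (1 / 4 : ℝ) • (b * (catalanSeries b * catalanSeries b)) := by
  have hs := summable_norm_catalan hb
  have hsq : catalanSeries b * catalanSeries b =
      ∑' n, ((catalan (n + 1) : ℝ) / 4 ^ n) • b ^ n := by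
    rw [catalanSeries, tsum_mul_tsum_eq_tsum_sum_antidiagonal_of_summable_norm hs hs]
    refine tsum_congr fun n => ?_
    rw [catalan_succ', Nat.cast_sum, Finset.sum_div, Finset.sum_smul]
    refine Finset.sum_congr rfl fun p hp => ?_
    rw [← Finset.HasAntidiagonal.mem_antidiagonal.1 hp, smul_mul_smul_comm, ← pow_add,
      pow_add (4 : ℝ)]
    congr 1
    push_cast
    field_simp
  have hs' : Summable fun n => ((catalan (n + 1) : ℝ) / 4 ^ n) • b ^ n := by
    have h4 : Summable fun n => 4 * ((catalan (n + 1) : ℝ) / 4 ^ (n + 1)) :=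
      ((summable_nat_add_iff 1).2 summable_catalan_div_four_pow).mul_left 4
    refine Summable.of_norm_bounded h4 fun n => ?_
    rw [norm_smul, Real.norm_of_nonneg (by positivity)]
    refine (mul_le_of_le_one_right (by positivity)
      ((norm_pow_le b n).trans (pow_le_one₀ (norm_nonneg b) hb))).trans (le_of_eq ?_)
    rw [pow_succ]
    field_simp
  rw [hsq, ← hs'.tsum_mul_left, ← (hs'.mul_left b).tsum_const_smul, catalanSeries,
    hs.of_norm.tsum_eq_zero_add]
  congr 1
  · simp
  · refine tsum_congr fun n => ?_
    rw [mul_smul_comm, smul_smul, ← pow_succ']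
    congr 1
    rw [pow_succ]
    field_simp

/-- `√(1 - b) = 1 - (b / 2) C(b / 4)`. -/
theorem mul_self_one_sub_catalanSeries [CompleteSpace R] (hb : ‖b‖ ≤ 1) :
    (1 - (1 / 2 : ℝ) • (b * catalanSeries b)) * (1 - (1 / 2 : ℝ) • (b * catalanSeries b)) =
      1 - b := by
  have hc := (commute_catalanSeries (b := b)).eq
  have he := congrArg (b * ·) (catalanSeries_eq hb)
  set t := catalanSeries b
  have h : b * t * (b * t) = b * (b * (t * t)) := by
    rw [mul_assoc, ← mul_assoc t, ← hc]; simp only [mul_assoc]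
  simp only [mul_add, mul_one, mul_smul_comm] at he
  have h1 : (1 / 2 : ℝ) • (b * t) + (1 / 2 : ℝ) • (b * t) = b * t := by module
  rw [sub_mul, mul_sub, mul_sub, one_mul, one_mul, mul_one, smul_mul_smul_comm, h]
  rw [show (1 / 2 : ℝ) * (1 / 2) = 1 / 4 by norm_num]
  calc _ = 1 - ((1 / 2 : ℝ) • (b * t) + (1 / 2 : ℝ) • (b * t)) +
        (1 / 4 : ℝ) • (b * (b * (t * t))) := by abel
    _ = 1 - b := by rw [h1, he]; abel

end Ring

variable {E F : Type*} [NormedAddCommGroup E] [InnerProductSpace ℝ E] [CompleteSpace E]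
  [NormedAddCommGroup F] [InnerProductSpace ℝ F] [CompleteSpace F]

open ContinuousLinearMap

theorem isSelfAdjoint_mul_catalanSeries {B : E →L[ℝ] E} (hB : IsSelfAdjoint B) :
    IsSelfAdjoint (B * catalanSeries B) := by
  have hC : star (catalanSeries B) = catalanSeries B := by
    rw [catalanSeries, tsum_star]
    refine tsum_congr fun n => ?_
    rw [star_smul, star_pow, hB.star_eq, star_trivial]
  rw [isSelfAdjoint_iff, star_mul, hC, hB.star_eq]
  exact (commute_catalanSeries (b := B)).eq.symm

/-- Positivity of `1 - (b / 2) C(b / 4)` comes from `C(1 / 4) ≤ 2`. -/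
theorem exists_isPositive_sqrt_one_sub {B : E →L[ℝ] E} (hB : IsSelfAdjoint B) (hBn : ‖B‖ ≤ 1) :
    ∃ S : E →L[ℝ] E, S.IsPositive ∧ S * S = 1 - B := by
  rcases subsingleton_or_nontrivial E with hE | hE
  · exact ⟨0, isPositive_zero, Subsingleton.elim _ _⟩
  have hDsa := isSelfAdjoint_mul_catalanSeries hB
  have hDn : ‖B * catalanSeries B‖ ≤ 2 := by
    refine (norm_mul_le _ _).trans ?_
    nlinarith [norm_catalanSeries_le hBn, norm_nonneg B, norm_nonneg (catalanSeries B)]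
  refine ⟨_, ?_, mul_self_one_sub_catalanSeries hBn⟩
  generalize B * catalanSeries B = D at hDsa hDn
  rw [isPositive_def']
  refine ⟨(IsSelfAdjoint.one _).sub ((IsSelfAdjoint.all _).smul hDsa), fun x => ?_⟩
  have h1 : inner ℝ (D x) x ≤ 2 * ‖x‖ ^ 2 := by
    refine (real_inner_le_norm _ _).trans ?_
    have := (le_opNorm D x).trans (mul_le_mul_of_nonneg_right hDn (norm_nonneg x))
    nlinarith [norm_nonneg x]
  have h2 : reApplyInnerSelf (1 - (1 / 2 : ℝ) • D) x = ‖x‖ ^ 2 - 1 / 2 * inner ℝ (D x) x := by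
    change inner ℝ (x - (1 / 2 : ℝ) • D x) x = _
    rw [inner_sub_left, real_inner_smul_left, real_inner_self_eq_norm_sq]
  linarith

/-- For `c ≥ ‖J‖` positive, `B = 1 - c⁻² J† J` has norm at most `1`, and `c √(1 - B)` is the
root. -/
theorem exists_isPositive_sqrt (J : E →L[ℝ] F) :
    ∃ S : E →L[ℝ] E, S.IsPositive ∧ S ∘L S = adjoint J ∘L J := by
  obtain ⟨c, hc, hJ⟩ : ∃ c : ℝ, 0 < c ∧ ‖J‖ ≤ c :=
    ⟨‖J‖ + 1, by positivity, by linarith⟩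
  have hAx (x : E) : inner ℝ x ((adjoint J ∘L J) x) = ‖J x‖ ^ 2 := by
    rw [comp_apply, adjoint_inner_right, real_inner_self_eq_norm_sq]
  have hAn (x : E) : ‖(adjoint J ∘L J) x‖ ^ 2 ≤ c ^ 2 * ‖J x‖ ^ 2 := by
    rw [← mul_pow]
    refine pow_le_pow_left₀ (norm_nonneg _) ((le_opNorm (adjoint J) (J x)).trans ?_) 2
    rw [LinearIsometryEquiv.norm_map]
    exact mul_le_mul_of_nonneg_right hJ (norm_nonneg _)
  have hAsa : IsSelfAdjoint (adjoint J ∘L J) := (isPositive_adjoint_comp_self J).isSelfAdjoint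
  generalize adjoint J ∘L J = A at *
  have hBn : ‖1 - (c ^ 2)⁻¹ • A‖ ≤ 1 := by
    refine opNorm_le_bound _ zero_le_one fun x => ?_
    rw [one_mul, ← sq_le_sq₀ (norm_nonneg _) (norm_nonneg _)]
    change ‖x - (c ^ 2)⁻¹ • A x‖ ^ 2 ≤ _
    rw [norm_sub_sq_real, inner_smul_right, hAx, norm_smul, mul_pow,
      Real.norm_of_nonneg (by positivity)]
    have h2 : ((c ^ 2)⁻¹) ^ 2 * ‖A x‖ ^ 2 ≤ (c ^ 2)⁻¹ * ‖J x‖ ^ 2 := by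
      calc ((c ^ 2)⁻¹) ^ 2 * ‖A x‖ ^ 2 ≤ ((c ^ 2)⁻¹) ^ 2 * (c ^ 2 * ‖J x‖ ^ 2) := by
            gcongr; exact hAn x
        _ = (c ^ 2)⁻¹ * ‖J x‖ ^ 2 := by field_simp
    have h3 : 0 ≤ (c ^ 2)⁻¹ * ‖J x‖ ^ 2 := by positivity
    linarith
  obtain ⟨S, hS, hSS⟩ := exists_isPositive_sqrt_one_sub
    ((IsSelfAdjoint.one _).sub ((IsSelfAdjoint.all _).smul hAsa)) hBn
  refine ⟨c • S, hS.smul_of_nonneg hc.le, ?_⟩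
  change (c • S) * (c • S) = A
  rw [smul_mul_smul_comm, hSS, sub_sub_cancel, smul_smul,
    show c * c * (c ^ 2)⁻¹ = 1 by field_simp, one_smul]

end SquareRoot

/-! ### Polar decomposition -/

section Polar

open ContinuousLinearMap

variable {E F : Type*} [NormedAddCommGroup E] [InnerProductSpace ℝ E] [CompleteSpace E]
  [NormedAddCommGroup F] [InnerProductSpace ℝ F] [CompleteSpace F]

theorem norm_eq_of_comp_self_eq {J : E →L[ℝ] F} {S : E →L[ℝ] E} (hS : S.IsPositive)
    (hSJ : S ∘L S = adjoint J ∘L J) (f : E) : ‖S f‖ = ‖J f‖ := by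
  have h : inner ℝ (S f) (S f) = inner ℝ (J f) (J f) := by
    rw [← adjoint_inner_right J, ← comp_apply, ← hSJ, comp_apply, hS.inner_left_eq_inner_right]
  rw [real_inner_self_eq_norm_sq, real_inner_self_eq_norm_sq] at h
  exact (sq_eq_sq₀ (norm_nonneg _) (norm_nonneg _)).1 h

/-- Polar decomposition `J = U S` along a positive square root `S` of `J† J`: the operator `U`
maps `S f` to `J f` and vanishes on `ker S = (range S)ᗮ`. -/
theorem exists_polar {J : E →L[ℝ] F} {S : E →L[ℝ] E} (hS : S.IsPositive)
    (hSJ : S ∘L S = adjoint J ∘L J) :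
    ∃ U : E →L[ℝ] F, U ∘L S = J ∧ (∀ f, S f = 0 → U f = 0) ∧
      U ∘L adjoint U = J.range.topologicalClosure.starProjection := by
  have hn := norm_eq_of_comp_self_eq hS hSJ
  set N := S.range.topologicalClosure with hN
  have hSN (f : E) : S f ∈ N := Submodule.le_topologicalClosure _ ⟨f, rfl⟩
  set e : E →L[ℝ] N := S.codRestrict N hSN with he
  have hdense : DenseRange (e : E →ₗ[ℝ] N) := by
    intro y
    rw [closure_subtype, ← Set.range_comp]
    exact y.2
  have hb : ∃ C, ∀ x, ‖(J : E →ₗ[ℝ] F) x‖ ≤ C * ‖(e : E →ₗ[ℝ] N) x‖ :=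
    ⟨1, fun x => by rw [one_mul]; exact (hn x).ge⟩
  set U : E →L[ℝ] F :=
    (J : E →ₗ[ℝ] F).extendOfNorm (e : E →ₗ[ℝ] N) ∘L N.orthogonalProjectionOnto with hU
  have hUS (f : E) : U (S f) = J f := by
    have h : N.orthogonalProjectionOnto (S f) = e f :=
      Submodule.orthogonalProjectionOnto_mem_subspace_eq_self (e f)
    rw [hU, comp_apply, h]
    exact LinearMap.extendOfNorm_eq hdense hb f
  have hU0 (f : E) (hf : S f = 0) : U f = 0 := by
    have h : f ∈ Nᗮ := by
      rw [hN, Submodule.orthogonal_closure, Submodule.mem_orthogonal]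
      rintro _ ⟨g, rfl⟩
      have := hS.inner_left_eq_inner_right g f
      rw [hf, inner_zero_right] at this
      exact this
    have h0 : N.orthogonalProjectionOnto f = 0 := by
      refine Subtype.ext ?_
      exact (Submodule.starProjection_apply_eq_zero_iff N).2 h
    rw [hU, comp_apply, h0, map_zero]
  have hsplit (h : E) : U h = U (N.starProjection h) := by
    rw [hU, comp_apply, comp_apply, Submodule.orthogonalProjectionOnto_starProjection_of_le le_rfl]
  have hUUS (f : E) : adjoint U (J f) = S f := by
    have hcl : ∀ h ∈ N, inner ℝ (J f) (U h) = inner ℝ (S f) h := fun h hh =>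
      closure_minimal (s := Set.range S) (t := {h | inner ℝ (J f) (U h) = inner ℝ (S f) h})
        (by
          rintro _ ⟨g, rfl⟩
          change inner ℝ (J f) (U (S g)) = inner ℝ (S f) (S g)
          rw [hUS, ← adjoint_inner_right J, ← comp_apply, ← hSJ, comp_apply,
            hS.inner_left_eq_inner_right])
        (isClosed_eq (by fun_prop) (by fun_prop)) hh
    refine ext_inner_right ℝ fun h => ?_
    rw [adjoint_inner_left, hsplit, hcl _ (Submodule.starProjection_apply_mem _ _),
      ← Submodule.inner_starProjection_left_eq_right,
      Submodule.starProjection_eq_self_iff.2 (hSN f)]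
  refine ⟨U, ContinuousLinearMap.ext hUS, hU0, ?_⟩
  ext y
  refine (Submodule.eq_starProjection_of_mem_orthogonal ?_ ?_).symm
  · rw [comp_apply, hsplit]
    exact closure_minimal (s := Set.range S) (t := U ⁻¹' J.range.topologicalClosure)
      (by
        rintro _ ⟨g, rfl⟩
        rw [Set.mem_preimage, hUS]
        exact Submodule.le_topologicalClosure _ ⟨g, rfl⟩)
      (J.range.isClosed_topologicalClosure.preimage U.continuous)
      (Submodule.starProjection_apply_mem N _)
  · rw [Submodule.orthogonal_closure, Submodule.mem_orthogonal]
    rintro _ ⟨f, rfl⟩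
    change inner ℝ (J f) (y - U (adjoint U y)) = 0
    rw [inner_sub_right, ← adjoint_inner_left U, hUUS, adjoint_inner_right, hUS, sub_self]

end Polar

/-! ### The embedding of a reproducing kernel Hilbert space into `L²` -/

section Embedding

variable {α : Type*} {H : Type*} [NormedAddCommGroup H] [InnerProductSpace ℝ H]
  [CompleteSpace H] [RKHS ℝ H α ℝ]

theorem inner_kerFun_one (f : H) (x : α) : inner ℝ f (RKHS.kerFun H x 1) = f x := by
  rw [RKHS.inner_kerFun]; simp

theorem kerFun_one_apply (x y : α) : RKHS.kerFun H y 1 x = ker H x y :=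
  RKHS.kerFun_apply H y 1 x

theorem ker_self_eq (x : α) : ker H x x = ‖RKHS.kerFun H x 1‖ ^ 2 := by
  rw [← kerFun_one_apply, ← inner_kerFun_one, real_inner_self_eq_norm_sq]

theorem ker_self_nonneg (x : α) : 0 ≤ ker H x x := by
  rw [ker_self_eq]; positivity

theorem abs_apply_le (f : H) (x : α) : |f x| ≤ ‖f‖ * √(ker H x x) := by
  rw [← inner_kerFun_one, ker_self_eq, Real.sqrt_sq (norm_nonneg _)]
  exact abs_real_inner_le_norm _ _

/-- The span of the kernel functions is dense, and convergence in `H` is pointwise. -/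
theorem measurable_apply [MeasurableSpace α] (hk : ∀ y, Measurable fun x => ker H x y) (f : H) :
    Measurable (f : α → ℝ) := by
  have hf : f ∈ closure (Submodule.span ℝ {RKHS.kerFun H x v | (x : α) (v : ℝ)} : Set H) := by
    rw [← Submodule.topologicalClosure_coe, RKHS.kerFun_dense]
    trivial
  obtain ⟨u, hu, hlim⟩ := mem_closure_iff_seq_limit.1 hf
  refine measurable_of_tendsto_metrizable (f := fun n => (u n : α → ℝ)) (fun n => ?_)
    (tendsto_pi_nhds.2 fun x => ((RKHS.continuous_eval (𝕜 := ℝ) x).tendsto f).comp hlim)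
  refine Submodule.span_induction (p := fun (g : H) _ => Measurable (g : α → ℝ)) ?_ ?_ ?_ ?_ (hu n)
  · rintro _ ⟨y, v, rfl⟩
    have : (RKHS.kerFun H y v : α → ℝ) = fun x => v * ker H x y := by
      funext x
      rw [← mul_one v, ← smul_eq_mul v 1, map_smul, RKHS.coe_smul, Pi.smul_apply,
        kerFun_one_apply]
      simp
    rw [this]
    exact (hk y).const_mul v
  · rw [RKHS.coe_zero]; exact measurable_zero
  · intro g h _ _ hg hh
    rw [RKHS.coe_add]; exact hg.add hh
  · intro c g _ hg
    rw [RKHS.coe_smul]; exact hg.const_smul c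

variable {Ω : Type*} [MeasurableSpace Ω] {μ : Measure Ω} {X : Ω → α}

theorem memLp_apply (hm : ∀ f : H, AEStronglyMeasurable (fun ω => f (X ω)) μ)
    (hint : Integrable (fun ω => ker H (X ω) (X ω)) μ) (f : H) :
    MemLp (fun ω => f (X ω)) 2 μ := by
  rw [memLp_two_iff_integrable_sq (hm f)]
  refine (hint.const_mul (‖f‖ ^ 2)).mono' ((hm f).pow 2) (.of_forall fun ω => ?_)
  rw [Real.norm_of_nonneg (sq_nonneg _), ← sq_abs]
  calc |f (X ω)| ^ 2 ≤ (‖f‖ * √(ker H (X ω) (X ω))) ^ 2 := by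
        gcongr; exact abs_apply_le f _
    _ = ‖f‖ ^ 2 * ker H (X ω) (X ω) := by
        rw [mul_pow, Real.sq_sqrt (ker_self_nonneg _)]

/-- `J` sends `f` to the class in `L²` of the centered random variable `f (X) - E [f (X)]`. -/
def IsCenteredEmbedding (J : H →L[ℝ] Lp ℝ 2 μ) (X : Ω → α) : Prop :=
  ∀ f : H, J f =ᵐ[μ] fun ω => f (X ω) - ∫ ω', f (X ω') ∂μ

theorem exists_isCenteredEmbedding [IsProbabilityMeasure μ]
    (hm : ∀ f : H, AEStronglyMeasurable (fun ω => f (X ω)) μ)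
    (hint : Integrable (fun ω => ker H (X ω) (X ω)) μ) :
    ∃ J : H →L[ℝ] Lp ℝ 2 μ, IsCenteredEmbedding J X := by
  have hL (f : H) := memLp_apply hm hint f
  have hI (f : H) : Integrable (fun ω => f (X ω)) μ := (hL f).integrable one_le_two
  have hc (f : H) : MemLp (fun ω => f (X ω) - ∫ ω', f (X ω') ∂μ) 2 μ :=
    (hL f).sub (memLp_const _)
  let J₀ : H →ₗ[ℝ] Lp ℝ 2 μ :=
    { toFun := fun f => (hc f).toLp
      map_add' := fun f g => by
        rw [← MemLp.toLp_add]
        congr 1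
        funext ω
        simp only [RKHS.coe_add, Pi.add_apply]
        rw [integral_add (hI f) (hI g)]
        ring
      map_smul' := fun c f => by
        rw [RingHom.id_apply, ← MemLp.toLp_const_smul]
        congr 1
        funext ω
        simp only [RKHS.coe_smul, Pi.smul_apply, smul_eq_mul]
        rw [integral_const_mul]
        ring }
  refine ⟨J₀.mkContinuous √(∫ ω, ker H (X ω) (X ω) ∂μ) fun f => ?_, fun f => (hc f).coeFn_toLp⟩
  have h1 : ‖J₀ f‖ ^ 2 = variance (fun ω => f (X ω)) μ := by
    rw [variance_eq_integral (hm f).aemeasurable, ← real_inner_self_eq_norm_sq, L2.inner_def]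
    refine integral_congr_ae ?_
    filter_upwards [(hc f).coeFn_toLp] with ω hω
    change inner ℝ ((hc f).toLp _ ω) ((hc f).toLp _ ω) = _
    rw [hω, real_inner_self_eq_norm_sq, Real.norm_eq_abs, sq_abs]
  have h2 : ‖J₀ f‖ ^ 2 ≤ (√(∫ ω, ker H (X ω) (X ω) ∂μ) * ‖f‖) ^ 2 := by
    rw [h1, mul_pow, Real.sq_sqrt (integral_nonneg fun ω => ker_self_nonneg _)]
    refine (variance_le_expectation_sq (hm f)).trans ?_
    rw [mul_comm, ← integral_const_mul]
    refine integral_mono (hL f).integrable_sq (hint.const_mul _) fun ω => ?_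
    change f (X ω) ^ 2 ≤ _
    rw [← sq_abs]
    calc |f (X ω)| ^ 2 ≤ (‖f‖ * √(ker H (X ω) (X ω))) ^ 2 := by
          gcongr; exact abs_apply_le f _
      _ = ‖f‖ ^ 2 * ker H (X ω) (X ω) := by
          rw [mul_pow, Real.sq_sqrt (ker_self_nonneg _)]
  exact (sq_le_sq₀ (norm_nonneg _) (by positivity)).1 h2

end Embedding

/-! ### The conditional covariance operator through projections -/

section CondCov

open ContinuousLinearMap

variable {Ω : Type*} [MeasurableSpace Ω] {μ : Measure Ω} {α β : Type*} {X : Ω → α} {Y : Ω → β}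
  {H : Type*} [NormedAddCommGroup H] [InnerProductSpace ℝ H] [CompleteSpace H] [RKHS ℝ H α ℝ]
  {K : Type*} [NormedAddCommGroup K] [InnerProductSpace ℝ K] [CompleteSpace K] [RKHS ℝ K β ℝ]
  {JX : H →L[ℝ] Lp ℝ 2 μ} {JY : K →L[ℝ] Lp ℝ 2 μ}

omit [CompleteSpace H] in
/-- The defining property of `crossCov` determines the operator, and `JY† JX` has it. -/
theorem crossCov_eq (hX : IsCenteredEmbedding JX X) (hY : IsCenteredEmbedding JY Y) :
    crossCov H K μ X Y = adjoint JY ∘L JX := by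
  have hspec : ∀ (f : H) (g : K), inner ℝ g ((adjoint JY ∘L JX) f) =
      cov[fun ω => f (X ω), fun ω => g (Y ω); μ] := by
    intro f g
    rw [comp_apply, adjoint_inner_right, L2.inner_def, covariance]
    refine integral_congr_ae ?_
    filter_upwards [hX f, hY g] with ω h1 h2
    rw [h1, h2]
    rfl
  have h := Classical.epsilon_spec (p := fun A : H →L[ℝ] K => ∀ (f : H) (g : K),
    inner ℝ g (A f) = cov[fun ω => f (X ω), fun ω => g (Y ω); μ]) ⟨_, hspec⟩
  ext1 f
  exact ext_inner_left ℝ fun g => (h f g).trans (hspec f g).symm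

theorem opSqrt_spec {F : Type*} [NormedAddCommGroup F] [InnerProductSpace ℝ F] [CompleteSpace F]
    (J : H →L[ℝ] F) : (opSqrt (adjoint J ∘L J)).IsPositive ∧
      opSqrt (adjoint J ∘L J) ∘L opSqrt (adjoint J ∘L J) = adjoint J ∘L J :=
  Classical.epsilon_spec (p := fun S : H →L[ℝ] H => S.IsPositive ∧ S ∘L S = adjoint J ∘L J)
    (exists_isPositive_sqrt J)

theorem adjoint_comp_self_apply_eq_zero_iff {E F : Type*} [NormedAddCommGroup E]
    [InnerProductSpace ℝ E] [CompleteSpace E] [NormedAddCommGroup F] [InnerProductSpace ℝ F]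
    [CompleteSpace F] (J : E →L[ℝ] F) (f : E) : (adjoint J ∘L J) f = 0 ↔ J f = 0 := by
  refine ⟨fun h => ?_, fun h => by rw [comp_apply, h, map_zero]⟩
  rw [← inner_self_eq_zero (𝕜 := ℝ), ← adjoint_inner_right, ← comp_apply, h, inner_zero_right]

/-- For a self-adjoint operator, the closure of the range meets the kernel only in `0`. -/
theorem eq_zero_of_mem_closure_range {E : Type*} [NormedAddCommGroup E] [InnerProductSpace ℝ E]
    [CompleteSpace E] {A : E →L[ℝ] E} (hA : IsSelfAdjoint A) {x : E}
    (hx : x ∈ closure (Set.range A)) (h0 : A x = 0) : x = 0 := by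
  have h : ∀ y ∈ closure (Set.range A), inner ℝ x y = 0 := fun y hy =>
    closure_minimal (s := Set.range A) (t := {y | inner ℝ x y = 0})
      (by
        rintro _ ⟨z, rfl⟩
        change inner ℝ x (A z) = 0
        rw [← hA.adjoint_eq, adjoint_inner_right, h0, inner_zero_left])
      (isClosed_eq (by fun_prop) (by fun_prop)) hy
  exact inner_self_eq_zero.1 (h x hx)

/-- The correlation operator in terms of the polar factors `UX` and `UY` of `JX` and `JY`. -/
theorem corrOp_eq (hX : IsCenteredEmbedding JX X) (hY : IsCenteredEmbedding JY Y)
    {UX : H →L[ℝ] Lp ℝ 2 μ} {UY : K →L[ℝ] Lp ℝ 2 μ}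
    (hUX : UX ∘L opSqrt (adjoint JX ∘L JX) = JX)
    (hUX0 : ∀ f, opSqrt (adjoint JX ∘L JX) f = 0 → UX f = 0)
    (hUY : UY ∘L opSqrt (adjoint JY ∘L JY) = JY)
    (hUY0 : ∀ f, opSqrt (adjoint JY ∘L JY) f = 0 → UY f = 0) :
    corrOp H K μ X Y = adjoint UY ∘L UX := by
  obtain ⟨hSX, hSSX⟩ := opSqrt_spec JX
  obtain ⟨hSY, hSSY⟩ := opSqrt_spec JY
  have hnX := norm_eq_of_comp_self_eq hSX hSSX
  have hnY := norm_eq_of_comp_self_eq hSY hSSY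
  unfold corrOp
  simp only [crossCov_eq hX hY, crossCov_eq hX hX, crossCov_eq hY hY]
  set SX := opSqrt (adjoint JX ∘L JX)
  set SY := opSqrt (adjoint JY ∘L JY)
  have kX (f : H) : (adjoint JX ∘L JX) f = 0 ↔ SX f = 0 := by
    rw [adjoint_comp_self_apply_eq_zero_iff, ← norm_eq_zero, ← hnX, norm_eq_zero]
  have kY (f : K) : (adjoint JY ∘L JY) f = 0 ↔ SY f = 0 := by
    rw [adjoint_comp_self_apply_eq_zero_iff, ← norm_eq_zero, ← hnY, norm_eq_zero]
  have hAY : IsSelfAdjoint (adjoint JY ∘L JY) := (isPositive_adjoint_comp_self JY).isSelfAdjoint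
  have hspec : adjoint JY ∘L JX = SY ∘L (adjoint UY ∘L UX) ∘L SX ∧
      (∀ f : H, (adjoint JX ∘L JX) f = 0 → (adjoint UY ∘L UX) f = 0) ∧
      (∀ f : H, (adjoint UY ∘L UX) f ∈ closure (Set.range (adjoint JY ∘L JY))) := by
    refine ⟨?_, fun f hf => ?_, fun f => ?_⟩
    · calc adjoint JY ∘L JX = adjoint (UY ∘L SY) ∘L (UX ∘L SX) := by rw [hUX, hUY]
        _ = _ := by
          rw [adjoint_comp, hSY.isSelfAdjoint.adjoint_eq]; rfl
    · rw [comp_apply, hUX0 f ((kX f).1 hf), map_zero]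
    · -- the closure of the range is the orthogonal complement of the kernel
      have hcl : (closure (Set.range (adjoint JY ∘L JY)) : Set K) =
          ((adjoint JY ∘L JY).range.topologicalClosure : Submodule ℝ K) := rfl
      rw [hcl, ← Submodule.orthogonal_orthogonal_eq_closure, SetLike.mem_coe,
        Submodule.mem_orthogonal]
      intro g hg
      have h0 : SY g = 0 := by
        rw [← kY]
        refine ext_inner_left ℝ fun z => ?_
        rw [inner_zero_right, ← hAY.adjoint_eq, adjoint_inner_right]
        exact hg _ ⟨z, rfl⟩
      rw [comp_apply, adjoint_inner_right, hUY0 g h0, inner_zero_left]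
  have h := Classical.epsilon_spec (p := fun V : H →L[ℝ] K =>
    adjoint JY ∘L JX = SY ∘L V ∘L SX ∧ (∀ f : H, (adjoint JX ∘L JX) f = 0 → V f = 0) ∧
      (∀ f : H, V f ∈ closure (Set.range (adjoint JY ∘L JY)))) ⟨_, hspec⟩
  set V := Classical.epsilon (fun V : H →L[ℝ] K =>
    adjoint JY ∘L JX = SY ∘L V ∘L SX ∧ (∀ f : H, (adjoint JX ∘L JX) f = 0 → V f = 0) ∧
      (∀ f : H, V f ∈ closure (Set.range (adjoint JY ∘L JY))))
  -- two candidates agree on `range SX` and on `ker SX = (range SX)ᗮ`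
  have hcl : ∀ (W : H →L[ℝ] K) (f : H), W f ∈ closure (Set.range (adjoint JY ∘L JY)) ↔
      W f ∈ (adjoint JY ∘L JY).range.topologicalClosure := fun _ _ => Iff.rfl
  have hrange (f : H) : V (SX f) = (adjoint UY ∘L UX) (SX f) := by
    rw [← sub_eq_zero]
    refine eq_zero_of_mem_closure_range hAY
      (((adjoint JY ∘L JY).range.topologicalClosure).sub_mem
        ((hcl _ _).1 (h.2.2 _)) ((hcl _ _).1 (hspec.2.2 _))) ?_
    rw [kY, map_sub, sub_eq_zero]
    exact congr($(h.1.symm.trans hspec.1) f)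
  ext1 f
  have hmem : f - SX.range.topologicalClosure.starProjection f ∈ SX.rangeᗮ := by
    rw [← Submodule.orthogonal_closure]
    exact Submodule.sub_starProjection_mem_orthogonal f
  have hker : SX (f - SX.range.topologicalClosure.starProjection f) = 0 := by
    refine ext_inner_left ℝ fun z => ?_
    rw [inner_zero_right, ← hSX.inner_left_eq_inner_right]
    exact hmem _ ⟨z, rfl⟩
  have h1 : ∀ y ∈ SX.range.topologicalClosure, V y = (adjoint UY ∘L UX) y := fun y hy =>
    closure_minimal (s := Set.range SX) (t := {y | V y = (adjoint UY ∘L UX) y})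
      (by rintro _ ⟨z, rfl⟩; exact hrange z) (isClosed_eq (by fun_prop) (by fun_prop)) hy
  have h2 := h.2.1 _ ((kX _).2 hker)
  have h3 := hspec.2.1 _ ((kX _).2 hker)
  rw [map_sub, sub_eq_zero] at h2 h3
  rw [h2, h3]
  exact h1 _ (Submodule.starProjection_apply_mem _ _)

/-- The conditional covariance operator of `Y` given `X` is `JY† (1 - P) JY`, where `P` is the
orthogonal projection onto the closure in `L²` of the functions `f (X) - E [f (X)]`. -/
theorem condCov_eq (hX : IsCenteredEmbedding JX X) (hY : IsCenteredEmbedding JY Y) :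
    condCov H K μ X Y =
      adjoint JY ∘L (1 - JX.range.topologicalClosure.starProjection) ∘L JY := by
  obtain ⟨hSX, hSSX⟩ := opSqrt_spec JX
  obtain ⟨hSY, hSSY⟩ := opSqrt_spec JY
  obtain ⟨UX, hUX, hUX0, hP⟩ := exists_polar hSX hSSX
  obtain ⟨UY, hUY, hUY0, -⟩ := exists_polar hSY hSSY
  rw [condCov, corrOp_eq hX hY hUX hUX0 hUY hUY0, corrOp_eq hY hX hUY hUY0 hUX hUX0,
    crossCov_eq hY hY, ← hP]
  have h : adjoint JY = opSqrt (adjoint JY ∘L JY) ∘L adjoint UY := by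
    conv_lhs => rw [← hUY]
    rw [adjoint_comp, hSY.isSelfAdjoint.adjoint_eq]
  ext1 f
  have h1 : JY f = UY (opSqrt (adjoint JY ∘L JY) f) := congr($hUY.symm f)
  have h2 (z : Lp ℝ 2 μ) : adjoint JY z = opSqrt (adjoint JY ∘L JY) (adjoint UY z) :=
    congr($h z)
  simp only [sub_apply, comp_apply, map_sub]
  rw [← h1, ← h2]
  rfl

end CondCov

/-! ### Characteristic kernels -/

section TiltedLaw

variable {Ω : Type*} [MeasurableSpace Ω] {μ : Measure Ω} {α : Type*} [MeasurableSpace α]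
  {X : Ω → α} {w : Ω → ℝ}

/-- The law of `X` under the measure with density `w` (its positive part, for signed `w`) with
respect to `μ`. -/
def tiltedLaw (μ : Measure Ω) (X : Ω → α) (w : Ω → ℝ) : Measure α :=
  (μ.withDensity fun ω => ENNReal.ofReal (w ω)).map X

theorem tiltedLaw_apply (hX : Measurable X) (hw : Integrable w μ) (hw0 : 0 ≤ w) {A : Set α}
    (hA : MeasurableSet A) :
    tiltedLaw μ X w A = ENNReal.ofReal (∫ ω in X ⁻¹' A, w ω ∂μ) := by
  rw [tiltedLaw, Measure.map_apply hX hA, withDensity_apply _ (hX hA),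
    ofReal_integral_eq_lintegral_ofReal hw.integrableOn (.of_forall hw0)]

theorem isProbabilityMeasure_tiltedLaw (hX : Measurable X) (hw : Integrable w μ) (hw0 : 0 ≤ w)
    (hw1 : ∫ ω, w ω ∂μ = 1) : IsProbabilityMeasure (tiltedLaw μ X w) :=
  ⟨by rw [tiltedLaw_apply hX hw hw0 .univ, Set.preimage_univ, setIntegral_univ, hw1,
    ENNReal.ofReal_one]⟩

theorem integrable_tiltedLaw_iff (hX : Measurable X) (hw : Integrable w μ) (hw0 : 0 ≤ w)
    {φ : α → ℝ} (hφ : Measurable φ) :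
    Integrable φ (tiltedLaw μ X w) ↔ Integrable (fun ω => w ω * φ (X ω)) μ := by
  rw [tiltedLaw, integrable_map_measure hφ.aestronglyMeasurable hX.aemeasurable,
    integrable_withDensity_iff_integrable_smul₀' hw.aemeasurable.ennreal_ofReal
      (.of_forall fun _ => ENNReal.ofReal_lt_top)]
  refine integrable_congr (.of_forall fun ω => ?_)
  simp [ENNReal.toReal_ofReal (hw0 ω)]

theorem integral_tiltedLaw (hX : Measurable X) (hw : Integrable w μ) (hw0 : 0 ≤ w)
    {φ : α → ℝ} (hφ : Measurable φ) :
    ∫ x, φ x ∂tiltedLaw μ X w = ∫ ω, w ω * φ (X ω) ∂μ := by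
  rw [tiltedLaw, integral_map hX.aemeasurable hφ.aestronglyMeasurable,
    integral_withDensity_eq_integral_toReal_smul₀ hw.aemeasurable.ennreal_ofReal
      (.of_forall fun _ => ENNReal.ofReal_lt_top)]
  refine integral_congr_ae (.of_forall fun ω => ?_)
  simp [ENNReal.toReal_ofReal (hw0 ω)]

end TiltedLaw

section Characteristic

variable {α : Type*} [MeasurableSpace α] {H : Type*} [NormedAddCommGroup H]
  [InnerProductSpace ℝ H] [CompleteSpace H] [RKHS ℝ H α ℝ]

theorem measurable_ker_left (hk : Measurable fun p : α × α => ker H p.1 p.2) (y : α) :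
    Measurable fun x => ker H x y :=
  hk.comp (f := fun x => (x, y)) (by fun_prop)

theorem measurable_ker_diag (hk : Measurable fun p : α × α => ker H p.1 p.2) :
    Measurable fun x => ker H x x :=
  hk.comp (f := fun x => (x, x)) (by fun_prop)

variable {Ω : Type*} [MeasurableSpace Ω] {μ : Measure Ω} {X : Ω → α}

/-- If the centered `h ∈ L²` is orthogonal to all `f (X)`, then the normalized positive and
negative parts of `h` are densities under which `X` has the same mean embedding, hence the same
law. -/
theorem IsCharacteristic.setIntegral_preimage_eq_zero (hchar : IsCharacteristic H)
    (hk : Measurable fun p : α × α => ker H p.1 p.2) [IsProbabilityMeasure μ] (hX : Measurable X)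
    (hint : Integrable (fun ω => ker H (X ω) (X ω)) μ) {h : Ω → ℝ} (hh : MemLp h 2 μ)
    (h0 : ∫ ω, h ω ∂μ = 0) (horth : ∀ f : H, ∫ ω, h ω * f (X ω) ∂μ = 0) {A : Set α}
    (hA : MeasurableSet A) : ∫ ω in X ⁻¹' A, h ω ∂μ = 0 := by
  have hky (y : α) : Measurable fun x => ker H x y :=
    measurable_ker_left hk y
  have hkd : Measurable fun x => ker H x x := measurable_ker_diag hk
  have hi : Integrable h μ := hh.integrable one_le_two
  have hsplit (s : Set Ω) : ∫ ω in s, h ω ∂μ =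
      ∫ ω in s, max (h ω) 0 ∂μ - ∫ ω in s, max (-h ω) 0 ∂μ := by
    rw [← integral_sub hi.pos_part.integrableOn hi.neg_part.integrableOn]
    refine integral_congr_ae (.of_forall fun ω => ?_)
    rcases le_total (h ω) 0 with h' | h' <;> simp [h']
  set c := ∫ ω, max (h ω) 0 ∂μ with hc
  have hc' : ∫ ω, max (-h ω) 0 ∂μ = c := by
    have := hsplit Set.univ
    simp only [setIntegral_univ] at this
    linarith
  rcases eq_or_ne c 0 with hc0 | hc0
  · have h1 : (fun ω => max (h ω) 0) =ᵐ[μ] 0 :=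
      (integral_eq_zero_iff_of_nonneg (fun ω => le_max_right _ _) hi.pos_part).1 hc0
    have h2 : (fun ω => max (-h ω) 0) =ᵐ[μ] 0 :=
      (integral_eq_zero_iff_of_nonneg (fun ω => le_max_right _ _) hi.neg_part).1 (hc'.trans hc0)
    rw [hsplit, integral_eq_zero_of_ae (ae_restrict_of_ae h1),
      integral_eq_zero_of_ae (ae_restrict_of_ae h2), sub_zero]
  have hcpos : 0 < c := lt_of_le_of_ne (integral_nonneg fun ω => le_max_right _ _) hc0.symm
  -- the facts needed of either part `v` of `h`
  have key (v : Ω → ℝ) (hv : MemLp v 2 μ) (hv0 : 0 ≤ v) (hv1 : ∫ ω, v ω ∂μ = c) :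
      IsProbabilityMeasure (tiltedLaw μ X fun ω => c⁻¹ * v ω) ∧
      Integrable (fun x => √(ker H x x)) (tiltedLaw μ X fun ω => c⁻¹ * v ω) ∧
      (∀ y, ∫ x, ker H x y ∂(tiltedLaw μ X fun ω => c⁻¹ * v ω) =
        c⁻¹ * ∫ ω, v ω * RKHS.kerFun H y 1 (X ω) ∂μ) ∧
      (∀ y, Integrable (fun ω => v ω * RKHS.kerFun H y 1 (X ω)) μ) ∧
      tiltedLaw μ X (fun ω => c⁻¹ * v ω) A = ENNReal.ofReal (c⁻¹ * ∫ ω in X ⁻¹' A, v ω ∂μ) := by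
    have hw : Integrable (fun ω => c⁻¹ * v ω) μ := (hv.integrable one_le_two).const_mul _
    have hw0 : 0 ≤ fun ω => c⁻¹ * v ω := fun ω => mul_nonneg (inv_nonneg.2 hcpos.le) (hv0 ω)
    have hm (f : H) : AEStronglyMeasurable (fun ω => f (X ω)) μ :=
      ((measurable_apply hky f).comp hX).aestronglyMeasurable
    refine ⟨isProbabilityMeasure_tiltedLaw hX hw hw0 ?_, ?_, fun y => ?_, fun y => ?_, ?_⟩
    · rw [integral_const_mul, hv1, inv_mul_cancel₀ hc0]
    · rw [integrable_tiltedLaw_iff hX hw hw0 hkd.sqrt]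
      have hs : MemLp (fun ω => √(ker H (X ω) (X ω))) 2 μ := by
        have hsm : Measurable fun ω => √(ker H (X ω) (X ω)) := hkd.sqrt.comp hX
        rw [memLp_two_iff_integrable_sq hsm.aestronglyMeasurable]
        simpa only [Real.sq_sqrt (ker_self_nonneg _)] using hint
      have := (hv.integrable_mul hs).const_mul c⁻¹
      simpa only [Pi.mul_apply, mul_assoc] using this
    · rw [integral_tiltedLaw hX hw hw0 (hky y), ← integral_const_mul]
      simp only [mul_assoc, kerFun_one_apply]
    · exact hv.integrable_mul (memLp_apply hm hint _)
    · rw [tiltedLaw_apply hX hw hw0 hA, integral_const_mul]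
  obtain ⟨p1, p2, p3, p4, p5⟩ := key (fun ω => max (h ω) 0) hh.pos_part
    (fun ω => le_max_right _ _) rfl
  obtain ⟨n1, n2, n3, n4, n5⟩ := key (fun ω => max (-h ω) 0) hh.neg_part
    (fun ω => le_max_right _ _) hc'
  have heq := hchar _ _ p1 n1 p2 n2 fun y => by
    rw [p3, n3]
    congr 1
    refine sub_eq_zero.1 ?_
    rw [← integral_sub (p4 y) (n4 y)]
    refine (integral_congr_ae (.of_forall fun ω => ?_)).trans (horth (RKHS.kerFun H y 1))
    change max (h ω) 0 * _ - max (-h ω) 0 * _ = h ω * _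
    rw [← sub_mul]
    congr 1
    rcases le_total (h ω) 0 with h' | h' <;> simp [h']
  have hA' := p5.symm.trans ((congrArg (· A) heq).trans n5)
  have hnn (v : Ω → ℝ) (hv0 : 0 ≤ v) : 0 ≤ c⁻¹ * ∫ ω in X ⁻¹' A, v ω ∂μ :=
    mul_nonneg (inv_nonneg.2 hcpos.le) (integral_nonneg hv0)
  rw [ENNReal.ofReal_eq_ofReal_iff (hnn (fun ω => max (h ω) 0) fun ω => le_max_right _ _)
    (hnn (fun ω => max (-h ω) 0) fun ω => le_max_right _ _)] at hA'
  rw [hsplit, mul_left_cancel₀ (inv_ne_zero hc0) hA', sub_self]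

/-- The mean embedding of `ν`, by the Riesz representation theorem. -/
theorem exists_inner_eq_integral (hk : Measurable fun p : α × α => ker H p.1 p.2)
    {ν : Measure α} (hν : Integrable (fun x => √(ker H x x)) ν) :
    ∃ m : H, ∀ f : H, inner ℝ m f = ∫ x, f x ∂ν := by
  have hI (f : H) : Integrable (f : α → ℝ) ν :=
    (hν.const_mul ‖f‖).mono'
      (measurable_apply (measurable_ker_left hk) f).aestronglyMeasurable
      (.of_forall fun x => abs_apply_le f x)
  let L : H →ₗ[ℝ] ℝ :=
    { toFun := fun f => ∫ x, f x ∂ν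
      map_add' := fun f g => by
        simp only [RKHS.coe_add, Pi.add_apply]
        exact integral_add (hI f) (hI g)
      map_smul' := fun c f => by
        simp only [RKHS.coe_smul, Pi.smul_apply, RingHom.id_apply]
        exact integral_smul c f }
  have hb (f : H) : ‖L f‖ ≤ (∫ x, √(ker H x x) ∂ν) * ‖f‖ := by
    refine (norm_integral_le_integral_norm _).trans ?_
    rw [mul_comm, ← integral_const_mul]
    exact integral_mono (hI f).norm (hν.const_mul _) fun x => abs_apply_le f x
  refine ⟨(InnerProductSpace.toDual ℝ H).symm (L.mkContinuous _ hb), fun f => ?_⟩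
  rw [InnerProductSpace.toDual_symm_apply]
  rfl

/-- The pullback of a characteristic kernel along a map with a measurable left inverse is
characteristic. The difference `D` of the mean embeddings in `H` of two image measures is only
known to vanish on the range of `ι`, but both measures live there, so `‖D‖² = 0`. -/
theorem IsCharacteristic.of_leftInverse {β : Type*} [MeasurableSpace β] {K : Type*}
    [NormedAddCommGroup K] [InnerProductSpace ℝ K] [CompleteSpace K] [RKHS ℝ K β ℝ]
    (hchar : IsCharacteristic H) (hk : Measurable fun p : α × α => ker H p.1 p.2)
    {ι : β → α} {ρ : α → β} (hι : Measurable ι) (hρ : Measurable ρ)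
    (hρι : Function.LeftInverse ρ ι) (hK : ∀ u v, ker K u v = ker H (ι u) (ι v)) :
    IsCharacteristic K := by
  intro P Q hP hQ hPi hQi hPQ
  have hkd : Measurable fun x => ker H x x := measurable_ker_diag hk
  have hky (y : α) : Measurable fun x => ker H x y :=
    measurable_ker_left hk y
  have hint {ν : Measure β} (hν : Integrable (fun u => √(ker K u u)) ν) :
      Integrable (fun x => √(ker H x x)) (ν.map ι) := by
    rw [integrable_map_measure hkd.sqrt.aestronglyMeasurable hι.aemeasurable]
    simpa only [hK, Function.comp_def] using hν
  obtain ⟨mP, hmP⟩ := exists_inner_eq_integral hk (hint hPi)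
  obtain ⟨mQ, hmQ⟩ := exists_inner_eq_integral hk (hint hQi)
  have hval {ν : Measure β} {m : H} (hm : ∀ f : H, inner ℝ m f = ∫ x, f x ∂(ν.map ι)) (f : H) :
      inner ℝ m f = ∫ u, f (ι u) ∂ν := by
    rw [hm, integral_map hι.aemeasurable (measurable_apply hky f).aestronglyMeasurable]
  have hD0 (v : β) : (mP - mQ) (ι v) = 0 := by
    rw [← inner_kerFun_one, inner_sub_left, hval hmP, hval hmQ, sub_eq_zero]
    simpa only [kerFun_one_apply, hK] using hPQ v
  have hD : mP = mQ := by
    rw [← sub_eq_zero, ← inner_self_eq_zero (𝕜 := ℝ)]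
    conv_lhs => rw [inner_sub_left, hval hmP, hval hmQ]
    simp [hD0]
  have hmap : P.map ι = Q.map ι :=
    hchar _ _ (Measure.isProbabilityMeasure_map hι.aemeasurable)
      (Measure.isProbabilityMeasure_map hι.aemeasurable) (hint hPi) (hint hQi) fun y => by
        have h1 := hmP (RKHS.kerFun H y 1)
        have h2 := hmQ (RKHS.kerFun H y 1)
        rw [hD] at h1
        simpa only [kerFun_one_apply] using h1.symm.trans h2
  have hid (ν : Measure β) : (ν.map ι).map ρ = ν := by
    rw [Measure.map_map hρ hι, hρι.comp_eq_id, Measure.map_id]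
  rw [← hid P, hmap, hid]

end Characteristic

/-! ### The closed range of the embedding of a characteristic space -/

section ClosedRange

variable {Ω : Type*} [MeasurableSpace Ω] {μ : Measure Ω} [IsProbabilityMeasure μ]
  {α : Type*} [mα : MeasurableSpace α] {X : Ω → α}

theorem condExp_comap_eq_zero (hX : Measurable X) {h : Ω → ℝ} (hh : Integrable h μ)
    (h0 : ∀ A, MeasurableSet A → ∫ ω in X ⁻¹' A, h ω ∂μ = 0) : μ[h | mα.comap X] =ᵐ[μ] 0 := by
  refine (ae_eq_condExp_of_forall_setIntegral_eq hX.comap_le hh (fun _ _ _ => integrableOn_zero)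
    ?_ aestronglyMeasurable_zero).symm
  rintro _ ⟨A, hA, rfl⟩ -
  rw [h0 A hA]
  simp

theorem integral_eq_inner_const (h : Lp ℝ 2 μ) :
    ∫ ω, h ω ∂μ =
      inner ℝ (indicatorConstLp 2 MeasurableSet.univ (measure_ne_top μ _) (1 : ℝ)) h := by
  rw [L2.inner_indicatorConstLp_one, setIntegral_univ]

omit [IsProbabilityMeasure μ] in
theorem inner_Lp_eq_integral_mul (f g : Lp ℝ 2 μ) : inner ℝ f g = ∫ ω, f ω * g ω ∂μ := by
  rw [L2.inner_def]
  exact integral_congr_ae (.of_forall fun ω => mul_comm _ _)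

variable {H : Type*} [NormedAddCommGroup H] [InnerProductSpace ℝ H] [CompleteSpace H]
  [RKHS ℝ H α ℝ] {J : H →L[ℝ] Lp ℝ 2 μ}

omit [CompleteSpace H] mα in
theorem IsCenteredEmbedding.integral_eq_zero (hJ : IsCenteredEmbedding J X)
    (hL : ∀ f : H, MemLp (fun ω => f (X ω)) 2 μ) (f : H) : ∫ ω, J f ω ∂μ = 0 := by
  rw [integral_congr_ae (hJ f), integral_sub ((hL f).integrable one_le_two) (integrable_const _)]
  simp

omit [CompleteSpace H] mα in
theorem IsCenteredEmbedding.inner_eq (hJ : IsCenteredEmbedding J X)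
    (hL : ∀ f : H, MemLp (fun ω => f (X ω)) 2 μ) {h : Lp ℝ 2 μ} (h0 : ∫ ω, h ω ∂μ = 0) (f : H) :
    inner ℝ h (J f) = ∫ ω, h ω * f (X ω) ∂μ := by
  have h1 : inner ℝ h (J f) =
      ∫ ω, (h ω * f (X ω) - h ω * ∫ ω', f (X ω') ∂μ) ∂μ := by
    rw [inner_Lp_eq_integral_mul]
    refine integral_congr_ae ?_
    filter_upwards [hJ f] with ω hω
    rw [hω, mul_sub]
  have h2 : Integrable (fun ω => h ω * f (X ω)) μ := (Lp.memLp h).integrable_mul (hL f)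
  rw [h1, integral_sub h2
    (((Lp.memLp h).integrable one_le_two).mul_const _), integral_mul_const, h0, zero_mul, sub_zero]

omit [CompleteSpace H] [IsProbabilityMeasure μ] in
theorem IsCenteredEmbedding.aestronglyMeasurable (hJ : IsCenteredEmbedding J X)
    (hm : ∀ f : H, Measurable (f : α → ℝ)) (f : H) :
    AEStronglyMeasurable[mα.comap X] (J f) μ := by
  refine ⟨fun ω => f (X ω) - ∫ ω', f (X ω') ∂μ, ?_, hJ f⟩
  exact (((hm f).comp (comap_measurable X)).sub_const _).stronglyMeasurable

/-- For a characteristic `H`, the functions `f (X) - E [f (X)]` are dense among the centered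
`σ(X)`-measurable functions in `L²`. -/
theorem IsCharacteristic.mem_closure_range_iff (hchar : IsCharacteristic H)
    (hk : Measurable fun p : α × α => ker H p.1 p.2) (hX : Measurable X)
    (hint : Integrable (fun ω => ker H (X ω) (X ω)) μ) (hJ : IsCenteredEmbedding J X)
    (h : Lp ℝ 2 μ) : h ∈ J.range.topologicalClosure ↔
      AEStronglyMeasurable[mα.comap X] h μ ∧ ∫ ω, h ω ∂μ = 0 := by
  have hm : ∀ f : H, Measurable (f : α → ℝ) :=
    measurable_apply (measurable_ker_left hk)
  have hL : ∀ f : H, MemLp (fun ω => f (X ω)) 2 μ :=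
    memLp_apply (fun f => ((hm f).comp hX).aestronglyMeasurable) hint
  have hsub : ∀ h ∈ J.range.topologicalClosure,
      AEStronglyMeasurable[mα.comap X] h μ ∧ ∫ ω, h ω ∂μ = 0 := fun h hh =>
    closure_minimal (s := Set.range J)
      (t := {h : Lp ℝ 2 μ | AEStronglyMeasurable[mα.comap X] h μ} ∩
        {h : Lp ℝ 2 μ | ∫ ω, h ω ∂μ = 0})
      (by
        rintro _ ⟨f, rfl⟩
        exact ⟨hJ.aestronglyMeasurable hm f, hJ.integral_eq_zero hL f⟩)
      ((isClosed_aestronglyMeasurable hX.comap_le).inter (by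
        simp only [integral_eq_inner_const]
        exact isClosed_eq (by fun_prop) (by fun_prop))) hh
  refine ⟨hsub h, fun ⟨hhm, hh0⟩ => ?_⟩
  obtain ⟨hpm, hp0⟩ := hsub _ (Submodule.starProjection_apply_mem J.range.topologicalClosure h)
  set p := J.range.topologicalClosure.starProjection h with hp
  have hr0 : ∫ ω, (h - p) ω ∂μ = 0 := by
    rw [integral_eq_inner_const, inner_sub_right, ← integral_eq_inner_const,
      ← integral_eq_inner_const, hh0, hp0, sub_zero]
  have hrm : AEStronglyMeasurable[mα.comap X] (h - p : Lp ℝ 2 μ) μ :=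
    (hhm.sub hpm).congr (Lp.coeFn_sub h p).symm
  have hri : Integrable (h - p : Lp ℝ 2 μ) μ := (Lp.memLp _).integrable one_le_two
  have hA : ∀ A, MeasurableSet A → ∫ ω in X ⁻¹' A, (h - p) ω ∂μ = 0 := fun A hA =>
    hchar.setIntegral_preimage_eq_zero hk hX hint (Lp.memLp (h - p)) hr0 (fun f => by
      rw [← hJ.inner_eq hL hr0]
      exact Submodule.starProjection_inner_eq_zero h _
        (Submodule.le_topologicalClosure _ ⟨f, rfl⟩)) hA
  have hr : h - p = 0 := by
    rw [Lp.eq_zero_iff_ae_eq_zero]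
    exact (condExp_of_aestronglyMeasurable' hX.comap_le hrm hri).symm.trans
      (condExp_comap_eq_zero hX hri hA)
  rw [sub_eq_zero.1 hr]
  exact Submodule.starProjection_apply_mem _ h

end ClosedRange

/-! ### Compressions of nested projections -/

section Projections

open ContinuousLinearMap

variable {E F : Type*} [NormedAddCommGroup E] [InnerProductSpace ℝ E] [CompleteSpace E]
  [NormedAddCommGroup F] [InnerProductSpace ℝ F] [CompleteSpace F]
  {M N : Submodule ℝ F} [M.HasOrthogonalProjection] [N.HasOrthogonalProjection] (J : E →L[ℝ] F)

theorem isSelfAdjoint_adjoint_comp_one_sub_starProjection :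
    IsSelfAdjoint (adjoint J ∘L (1 - M.starProjection) ∘L J) :=
  ((IsSelfAdjoint.one _).sub (isSelfAdjoint_starProjection M)).adjoint_conj J

variable (h : N ≤ M)
include h

theorem adjoint_comp_one_sub_starProjection_le :
    adjoint J ∘L (1 - M.starProjection) ∘L J ≤ adjoint J ∘L (1 - N.starProjection) ∘L J := by
  have hp := (Submodule.starProjection_le_starProjection_iff.2 h).adjoint_conj J
  rw [le_def]
  convert hp using 1
  ext1 f
  simp only [sub_apply, comp_apply, map_sub]
  abel

omit [CompleteSpace F] in
/-- The difference of nested projections is a projection. -/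
theorem norm_starProjection_sub_sq (u : F) :
    ‖M.starProjection u - N.starProjection u‖ ^ 2 =
      inner ℝ u (M.starProjection u - N.starProjection u) := by
  have hM : M.starProjection (M.starProjection u - N.starProjection u) =
      M.starProjection u - N.starProjection u :=
    Submodule.starProjection_eq_self_iff.2 (M.sub_mem (Submodule.starProjection_apply_mem _ _)
      (h (Submodule.starProjection_apply_mem _ _)))
  have hN : N.starProjection (M.starProjection u - N.starProjection u) = 0 := by
    rw [map_sub, ← comp_apply, Submodule.starProjection_comp_starProjection_of_le h,
      Submodule.starProjection_eq_self_iff.2 (Submodule.starProjection_apply_mem N u), sub_self]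
  rw [← real_inner_self_eq_norm_sq]
  conv_lhs => rw [inner_sub_left, Submodule.inner_starProjection_left_eq_right,
    Submodule.inner_starProjection_left_eq_right, hM, hN, inner_zero_right, sub_zero]

theorem adjoint_comp_one_sub_starProjection_eq_iff :
    adjoint J ∘L (1 - M.starProjection) ∘L J = adjoint J ∘L (1 - N.starProjection) ∘L J ↔
      ∀ g, M.starProjection (J g) = N.starProjection (J g) := by
  have happ (P : F →L[ℝ] F) (g : E) :
      (adjoint J ∘L (1 - P) ∘L J) g = adjoint J (J g) - adjoint J (P (J g)) := by
    rw [← map_sub]; rfl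
  refine ⟨fun heq g => ?_, fun heq => ?_⟩
  · have h1 := congr($heq g)
    rw [happ, happ, sub_right_inj] at h1
    rw [← sub_eq_zero, ← norm_eq_zero, ← sq_eq_zero_iff, norm_starProjection_sub_sq h,
      ← adjoint_inner_right, map_sub, h1, sub_self, inner_zero_right]
  · ext1 g
    rw [happ, happ, heq]

end Projections

/-! ### Conditional independence -/

section CondIndep

variable {Ω : Type*} [m₀ : MeasurableSpace Ω] {μ : Measure Ω} [IsProbabilityMeasure μ]

theorem integral_mul_condExp {m : MeasurableSpace Ω} (hm : m ≤ m₀) {f g : Ω → ℝ}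
    (hf : AEStronglyMeasurable[m] f μ) (hfg : Integrable (fun ω => f ω * g ω) μ)
    (hg : Integrable g μ) : ∫ ω, f ω * μ[g | m] ω ∂μ = ∫ ω, f ω * g ω ∂μ := by
  rw [← integral_condExp (f := fun ω => f ω * g ω) hm]
  exact integral_congr_ae (condExp_mul_of_aestronglyMeasurable_left hf hfg hg).symm

theorem memLp_indicator_one {s : Set Ω} (hs : MeasurableSet s) :
    MemLp (s.indicator fun _ => (1 : ℝ)) 2 μ :=
  (memLp_const 1).indicator hs

omit [IsProbabilityMeasure μ] in
theorem setIntegral_eq_indicator_mul {s : Set Ω} (hs : MeasurableSet s) (f : Ω → ℝ) :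
    ∫ ω in s, f ω ∂μ = ∫ ω, s.indicator (fun _ => (1 : ℝ)) ω * f ω ∂μ := by
  rw [← integral_indicator hs]
  refine integral_congr_ae (.of_forall fun ω => ?_)
  by_cases h : ω ∈ s <;> simp [h]

variable {α β γ : Type*} [mα : MeasurableSpace α] [mβ : MeasurableSpace β]
  [mγ : MeasurableSpace γ] {X : Ω → α} {Y : Ω → β} {Z : Ω → γ}

omit [IsProbabilityMeasure μ] in
theorem CondIndepGiven.symm (h : CondIndepGiven μ Y X Z) : CondIndepGiven μ X Y Z :=
  fun A B hA hB => by
    rw [Set.inter_comm, mul_comm]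
    exact h B A hB hA

/-- Both sides of `P(B ∩ A) = ∫_B P(A | Z)` are the mean of `P(B | Z) P(A | Z)`. -/
theorem CondIndepGiven.setIntegral_sub_condExp (h : CondIndepGiven μ Y X Z) (hX : Measurable X)
    (hY : Measurable Y) (hZ : Measurable Z) {A : Set α} (hA : MeasurableSet A) {B : Set β}
    (hB : MeasurableSet B) :
    ∫ ω in Y ⁻¹' B, ((X ⁻¹' A).indicator (fun _ => (1 : ℝ)) ω - (μ⟦X ⁻¹' A | mγ.comap Z⟧) ω) ∂μ
      = 0 := by
  have hm := hZ.comap_le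
  have hiA := memLp_indicator_one (μ := μ) (hX hA)
  have hiB := memLp_indicator_one (μ := μ) (hY hB)
  have ha : MemLp (μ⟦X ⁻¹' A | mγ.comap Z⟧) 2 μ := hiA.condExp one_le_two
  rw [integral_sub (hiA.integrable one_le_two).integrableOn
    (ha.integrable one_le_two).integrableOn, sub_eq_zero]
  have h1 : ∫ ω in Y ⁻¹' B, (μ⟦X ⁻¹' A | mγ.comap Z⟧) ω ∂μ =
      ∫ ω, (μ⟦X ⁻¹' A | mγ.comap Z⟧) ω * (μ⟦Y ⁻¹' B | mγ.comap Z⟧) ω ∂μ := by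
    rw [setIntegral_eq_indicator_mul (hY hB), integral_mul_condExp hm
      stronglyMeasurable_condExp.aestronglyMeasurable (ha.integrable_mul hiB)
      (hiB.integrable one_le_two)]
    exact integral_congr_ae (.of_forall fun ω => mul_comm _ _)
  have h2 : ∫ ω, (μ⟦X ⁻¹' A | mγ.comap Z⟧) ω * (μ⟦Y ⁻¹' B | mγ.comap Z⟧) ω ∂μ =
      ∫ ω, (μ⟦Y ⁻¹' B ∩ X ⁻¹' A | mγ.comap Z⟧) ω ∂μ :=
    integral_congr_ae ((h B A hB hA).symm.mono fun ω hω => by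
      rw [← hω, Pi.mul_apply, mul_comm])
  rw [h1, h2, integral_condExp hm, integral_indicator ((hY hB).inter (hX hA)),
    setIntegral_indicator (hX hA)]

/-- A converse of `CondIndepGiven.setIntegral_sub_condExp` when `Z` is a function of `X`: the test
set `A` may then be intersected with the events of `σ(Z)`. -/
theorem condIndepGiven_of_setIntegral_eq (hX : Measurable X) (hY : Measurable Y)
    (hZ : Measurable Z) (hZX : mγ.comap Z ≤ mα.comap X)
    (h : ∀ (A : Set α) (B : Set β), MeasurableSet A → MeasurableSet B →
      ∫ ω in Y ⁻¹' B, ((X ⁻¹' A).indicator (fun _ => (1 : ℝ)) ω -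
        (μ⟦X ⁻¹' A | mγ.comap Z⟧) ω) ∂μ = 0) :
    CondIndepGiven μ Y X Z := by
  intro B A hB hA
  have hm := hZ.comap_le
  have hiA := memLp_indicator_one (μ := μ) (hX hA)
  have hiB := memLp_indicator_one (μ := μ) (hY hB)
  have ha : MemLp (μ⟦X ⁻¹' A | mγ.comap Z⟧) 2 μ := hiA.condExp one_le_two
  have hb : MemLp (μ⟦Y ⁻¹' B | mγ.comap Z⟧) 2 μ := hiB.condExp one_le_two
  have hiBA := memLp_indicator_one (μ := μ) ((hY hB).inter (hX hA))
  refine (ae_eq_condExp_of_forall_setIntegral_eq hm (hiBA.integrable one_le_two)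
    (fun _ _ _ => (hb.integrable_mul ha).integrableOn) ?_
    (stronglyMeasurable_condExp.mul stronglyMeasurable_condExp).aestronglyMeasurable).symm
  intro C hC _
  obtain ⟨A', hA', hAC⟩ := hZX C hC
  have hC₀ := hm C hC
  have hset : X ⁻¹' A ∩ C = X ⁻¹' (A ∩ A') := by rw [← hAC]; rfl
  have hiAA := memLp_indicator_one (μ := μ) (hX (hA.inter hA'))
  have haa : MemLp (μ⟦X ⁻¹' (A ∩ A') | mγ.comap Z⟧) 2 μ := hiAA.condExp one_le_two
  have hBA := h (A ∩ A') B (hA.inter hA') hB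
  rw [integral_sub (hiAA.integrable one_le_two).integrableOn
    (haa.integrable one_le_two).integrableOn, sub_eq_zero] at hBA
  have hpull : (μ⟦X ⁻¹' (A ∩ A') | mγ.comap Z⟧) =ᵐ[μ]
      C.indicator (μ⟦X ⁻¹' A | mγ.comap Z⟧) := by
    rw [← hset, Set.inter_comm, ← Set.indicator_indicator]
    exact condExp_indicator (hiA.integrable one_le_two) hC
  calc ∫ ω in C, ((μ⟦Y ⁻¹' B | mγ.comap Z⟧) * (μ⟦X ⁻¹' A | mγ.comap Z⟧)) ω ∂μ
      = ∫ ω, C.indicator (μ⟦X ⁻¹' A | mγ.comap Z⟧) ω * (μ⟦Y ⁻¹' B | mγ.comap Z⟧) ω ∂μ := by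
        rw [← integral_indicator hC₀]
        refine integral_congr_ae (.of_forall fun ω => ?_)
        by_cases hω : ω ∈ C <;> simp [hω, mul_comm]
    _ = ∫ ω, C.indicator (μ⟦X ⁻¹' A | mγ.comap Z⟧) ω *
          (Y ⁻¹' B).indicator (fun _ => (1 : ℝ)) ω ∂μ :=
        integral_mul_condExp hm (stronglyMeasurable_condExp.indicator hC).aestronglyMeasurable
          ((ha.indicator hC₀).integrable_mul hiB) (hiB.integrable one_le_two)
    _ = ∫ ω in Y ⁻¹' B, (μ⟦X ⁻¹' (A ∩ A') | mγ.comap Z⟧) ω ∂μ := by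
        rw [setIntegral_eq_indicator_mul (hY hB)]
        refine integral_congr_ae (hpull.mono fun ω hω => ?_)
        change _ * _ = _ * _
        rw [hω, mul_comm]
    _ = ∫ ω in Y ⁻¹' B, (X ⁻¹' (A ∩ A')).indicator (fun _ => (1 : ℝ)) ω ∂μ := hBA.symm
    _ = ∫ ω in C, (Y ⁻¹' B ∩ X ⁻¹' A).indicator (fun _ => (1 : ℝ)) ω ∂μ := by
        rw [← integral_indicator (hY hB), ← integral_indicator hC₀, ← hset]
        simp only [Set.indicator_indicator]
        rw [← Set.inter_assoc, Set.inter_comm _ C]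

variable {K : Type*} [NormedAddCommGroup K] [InnerProductSpace ℝ K] [CompleteSpace K]
  [RKHS ℝ K β ℝ] {JY : K →L[ℝ] Lp ℝ 2 μ} {M N : Submodule ℝ (Lp ℝ 2 μ)}
  [M.HasOrthogonalProjection] [N.HasOrthogonalProjection]

omit [IsProbabilityMeasure μ] in
theorem inner_toLp_eq_integral_mul {f : Ω → ℝ} (hf : MemLp f 2 μ) (g : Lp ℝ 2 μ) :
    inner ℝ hf.toLp g = ∫ ω, f ω * g ω ∂μ := by
  rw [inner_Lp_eq_integral_mul]
  exact integral_congr_ae (hf.coeFn_toLp.mono fun ω hω => by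
    change _ * _ = _ * _
    rw [hω])

/-- Equality of the projections of all `g (Y)` makes `1_A - E[1_A | Z]`, for `A ∈ σ(X)`,
orthogonal to all `g (Y)`, and the density of these functions in `L²(σ(Y))` gives conditional
independence. -/
theorem condIndepGiven_of_starProjection_eq (hchar : IsCharacteristic K)
    (hk : Measurable fun p : β × β => ker K p.1 p.2) (hX : Measurable X) (hY : Measurable Y)
    (hZ : Measurable Z) (hZX : mγ.comap Z ≤ mα.comap X)
    (hint : Integrable (fun ω => ker K (Y ω) (Y ω)) μ) (hJY : IsCenteredEmbedding JY Y)
    (hM : ∀ h : Lp ℝ 2 μ, h ∈ M ↔ AEStronglyMeasurable[mα.comap X] h μ ∧ ∫ ω, h ω ∂μ = 0)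
    (hN : ∀ h : Lp ℝ 2 μ, h ∈ N ↔ AEStronglyMeasurable[mγ.comap Z] h μ ∧ ∫ ω, h ω ∂μ = 0)
    (heq : ∀ g, M.starProjection (JY g) = N.starProjection (JY g)) :
    CondIndepGiven μ Y X Z := by
  refine condIndepGiven_of_setIntegral_eq hX hY hZ hZX fun A B hA hB => ?_
  have hm := hZ.comap_le
  have hL : ∀ f : K, MemLp (fun ω => f (Y ω)) 2 μ := memLp_apply (fun f =>
    ((measurable_apply (measurable_ker_left hk) f).comp hY).aestronglyMeasurable) hint
  have hiA := memLp_indicator_one (μ := μ) (hX hA)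
  have ha : MemLp (μ⟦X ⁻¹' A | mγ.comap Z⟧) 2 μ := hiA.condExp one_le_two
  set w : Ω → ℝ := fun ω =>
    (X ⁻¹' A).indicator (fun _ => (1 : ℝ)) ω - (μ⟦X ⁻¹' A | mγ.comap Z⟧) ω with hw
  have hwL : MemLp w 2 μ := hiA.sub ha
  have hw0 : ∫ ω, w ω ∂μ = 0 := by
    rw [hw, integral_sub (hiA.integrable one_le_two) (ha.integrable one_le_two),
      integral_condExp hm, sub_self]
  have hW0 : ∫ ω, hwL.toLp w ω ∂μ = 0 := (integral_congr_ae hwL.coeFn_toLp).trans hw0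
  have hWM : hwL.toLp w ∈ M := by
    refine (hM _).2 ⟨AEStronglyMeasurable.congr ?_ hwL.coeFn_toLp.symm, hW0⟩
    have hAX : MeasurableSet[mα.comap X] (X ⁻¹' A) := ⟨A, hA, rfl⟩
    exact ((stronglyMeasurable_const.indicator hAX).sub
      (stronglyMeasurable_condExp.mono hZX)).aestronglyMeasurable
  have hWN : ∀ n ∈ N, inner ℝ (hwL.toLp w) n = 0 := by
    intro n hn
    have hnL := Lp.memLp n
    have hi1 : Integrable (fun ω => n ω * (X ⁻¹' A).indicator (fun _ => (1 : ℝ)) ω) μ :=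
      hnL.integrable_mul hiA
    have hi2 : Integrable (fun ω => n ω * (μ⟦X ⁻¹' A | mγ.comap Z⟧) ω) μ :=
      hnL.integrable_mul ha
    rw [inner_toLp_eq_integral_mul]
    simp only [mul_comm _ (n _), hw, mul_sub]
    rw [integral_sub hi1 hi2, integral_mul_condExp hm ((hN n).1 hn).1 hi1
      (hiA.integrable one_le_two), sub_self]
  refine hchar.setIntegral_preimage_eq_zero hk hY hint hwL hw0 (fun g => ?_) hB
  have h1 : inner ℝ (hwL.toLp w) (JY g) = ∫ ω, w ω * g (Y ω) ∂μ := by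
    rw [hJY.inner_eq hL hW0]
    exact integral_congr_ae (hwL.coeFn_toLp.mono fun ω hω => by
      change _ * _ = _ * _
      rw [hω])
  rw [← h1, ← Submodule.starProjection_eq_self_iff.2 hWM,
    Submodule.inner_starProjection_left_eq_right, heq]
  exact hWN _ (Submodule.starProjection_apply_mem _ _)

/-- Conditional independence says `E[1_B | X] = E[1_B | Z]` for `B ∈ σ(Y)`. The difference `q` of
the two projections of `g (Y)` lies in `M` and is orthogonal to `N`, so it integrates to `0`
over `σ(Y)`, hence is orthogonal to `g (Y)`. -/
theorem starProjection_eq_of_condIndepGiven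
    (hk : Measurable fun p : β × β => ker K p.1 p.2) (hX : Measurable X) (hY : Measurable Y)
    (hZ : Measurable Z) (hNM : N ≤ M) (hJY : IsCenteredEmbedding JY Y)
    (hM : ∀ h : Lp ℝ 2 μ, h ∈ M ↔ AEStronglyMeasurable[mα.comap X] h μ ∧ ∫ ω, h ω ∂μ = 0)
    (hN : ∀ h : Lp ℝ 2 μ, h ∈ N ↔ AEStronglyMeasurable[mγ.comap Z] h μ ∧ ∫ ω, h ω ∂μ = 0)
    (hci : CondIndepGiven μ Y X Z) (g : K) :
    M.starProjection (JY g) = N.starProjection (JY g) := by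
  set q : Lp ℝ 2 μ := M.starProjection (JY g) - N.starProjection (JY g) with hq
  have hqM : q ∈ M := M.sub_mem (Submodule.starProjection_apply_mem _ _)
    (hNM (Submodule.starProjection_apply_mem _ _))
  have hqN : ∀ n ∈ N, inner ℝ n q = 0 := by
    intro n hn
    rw [hq, inner_sub_right, ← Submodule.inner_starProjection_left_eq_right,
      ← Submodule.inner_starProjection_left_eq_right,
      Submodule.starProjection_eq_self_iff.2 (hNM hn), Submodule.starProjection_eq_self_iff.2 hn,
      sub_self]
  obtain ⟨hqm, hq0⟩ := (hM q).1 hqM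
  have hqL := Lp.memLp q
  have hqi : Integrable q μ := hqL.integrable one_le_two
  have hB (B : Set β) (hB : MeasurableSet B) : ∫ ω in Y ⁻¹' B, q ω ∂μ = 0 := by
    have hiB := memLp_indicator_one (μ := μ) (hY hB)
    set b := μ⟦Y ⁻¹' B | mγ.comap Z⟧
    have hbL : MemLp b 2 μ := hiB.condExp one_le_two
    have hbi := hbL.integrable one_le_two
    have hdL : MemLp (fun ω => (Y ⁻¹' B).indicator (fun _ => (1 : ℝ)) ω - b ω) 2 μ :=
      hiB.sub hbL
    have hdi := hdL.integrable one_le_two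
    -- `E[1_B | X] = E[1_B | Z]`
    have hzero : μ[fun ω => (Y ⁻¹' B).indicator (fun _ => (1 : ℝ)) ω - b ω | mα.comap X] =ᵐ[μ] 0 :=
      condExp_comap_eq_zero hX hdi fun A hA =>
        hci.symm.setIntegral_sub_condExp hY hX hZ hB hA
    have h1 : ∫ ω, q ω * ((Y ⁻¹' B).indicator (fun _ => (1 : ℝ)) ω - b ω) ∂μ = 0 := by
      rw [← integral_mul_condExp hX.comap_le hqm (hqL.integrable_mul hdL) hdi]
      exact integral_eq_zero_of_ae (hzero.mono fun ω hω => by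
        change _ * _ = _
        rw [hω]; simp)
    -- `b` is constant plus an element of `N`, and `q` is centered and orthogonal to `N`
    have hcL : MemLp (fun ω => b ω - ∫ ω', b ω' ∂μ) 2 μ := hbL.sub (memLp_const _)
    have hcN : hcL.toLp ∈ N := by
      refine (hN _).2 ⟨AEStronglyMeasurable.congr ?_ hcL.coeFn_toLp.symm, ?_⟩
      · exact (stronglyMeasurable_condExp.sub stronglyMeasurable_const).aestronglyMeasurable
      · rw [integral_congr_ae hcL.coeFn_toLp, integral_sub hbi (integrable_const _)]
        simp
    have hi1 : Integrable (fun ω => q ω * b ω) μ := hqL.integrable_mul hbL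
    have h2 : ∫ ω, q ω * b ω ∂μ = 0 := by
      have := hqN _ hcN
      rw [inner_toLp_eq_integral_mul] at this
      simp only [mul_comm _ (q _), mul_sub] at this
      rwa [integral_sub hi1 (hqi.mul_const _), integral_mul_const, hq0, zero_mul, sub_zero]
        at this
    have hi2 : Integrable (fun ω => q ω * (Y ⁻¹' B).indicator (fun _ => (1 : ℝ)) ω) μ :=
      hqL.integrable_mul hiB
    simp only [mul_sub] at h1
    rw [integral_sub hi2 hi1, h2, sub_zero] at h1
    rw [setIntegral_eq_indicator_mul (hY hB)]
    simpa only [mul_comm] using h1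
  have hort : inner ℝ (JY g) q = 0 := by
    rw [inner_Lp_eq_integral_mul, ← integral_mul_condExp hY.comap_le
      (hJY.aestronglyMeasurable (measurable_apply (measurable_ker_left hk)) g)
      ((Lp.memLp _).integrable_mul hqL) hqi]
    exact integral_eq_zero_of_ae ((condExp_comap_eq_zero hY hqi hB).mono fun ω hω => by
      change _ * _ = _
      rw [hω]; simp)
  rw [← sub_eq_zero, ← norm_eq_zero, ← sq_eq_zero_iff, norm_starProjection_sub_sq hNM]
  exact hort

end CondIndep

/-! ### Selection of features -/

section Selection

variable {d : ℕ} {T : Finset (Fin d)} {𝒳 : Set (Fin d → ℝ)}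

theorem measurable_embed : Measurable (embed : subDomain T 𝒳 → 𝒳) := by
  refine Measurable.subtype_mk (measurable_pi_iff.2 fun i => ?_)
  by_cases h : i ∈ T
  · simp only [zeroExt, h, dif_pos]
    exact (measurable_pi_apply _).comp measurable_subtype_coe
  · simp [zeroExt, h]

theorem measurable_select (h𝒳 : ∀ x ∈ 𝒳, mask T x ∈ 𝒳) : Measurable (select h𝒳) :=
  ((Finset.measurable_restrict T).comp measurable_subtype_coe).subtype_mk

theorem leftInverse_select_embed (h𝒳 : ∀ x ∈ 𝒳, mask T x ∈ 𝒳) :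
    Function.LeftInverse (select h𝒳) embed := fun u =>
  Subtype.ext (funext fun i => by simp [select, embed, zeroExt])

end Selection

end CondCovOp

end

theorem theorem1
    {d : ℕ} (𝒳 : Set (Fin d → ℝ)) (T : Finset (Fin d))
    (h𝒳 : ∀ x ∈ 𝒳, CondCovOp.mask T x ∈ 𝒳)
    {𝒴 : Type*} [MeasurableSpace 𝒴]
    -- the RKHSs `(H₁, k₁)` on `𝒳` and `(H₂, k₂)` on `𝒴`
    (H₁ : Type*) [NormedAddCommGroup H₁] [InnerProductSpace ℝ H₁] [CompleteSpace H₁]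
    [RKHS ℝ H₁ 𝒳 ℝ]
    (H₂ : Type*) [NormedAddCommGroup H₂] [InnerProductSpace ℝ H₂] [CompleteSpace H₂]
    [RKHS ℝ H₂ 𝒴 ℝ]
    -- the RKHS on the selected coordinates whose kernel is `k₁ (x^T, x'^T)`
    (HT : Type*) [NormedAddCommGroup HT] [InnerProductSpace ℝ HT] [CompleteSpace HT]
    [RKHS ℝ HT (CondCovOp.subDomain T 𝒳) ℝ]
    (hHT : ∀ u v, CondCovOp.ker HT u v =
      CondCovOp.ker H₁ (CondCovOp.embed u) (CondCovOp.embed v))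
    (hk₁ : Measurable fun p : 𝒳 × 𝒳 => CondCovOp.ker H₁ p.1 p.2)
    (hk₂ : Measurable fun p : 𝒴 × 𝒴 => CondCovOp.ker H₂ p.1 p.2)
    (hchar₁ : CondCovOp.IsCharacteristic H₁)
    (hchar₂ : CondCovOp.IsCharacteristic H₂)
    -- the random vector `(X, Y)`, with kernels bounded in expectation
    {Ω : Type*} [MeasurableSpace Ω] (μ : Measure Ω) [IsProbabilityMeasure μ]
    (X : Ω → 𝒳) (hX : Measurable X) (Y : Ω → 𝒴) (hY : Measurable Y)
    (hint₁ : Integrable (fun ω => CondCovOp.ker H₁ (X ω) (X ω)) μ)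
    (hintT : Integrable (fun ω => CondCovOp.ker HT (CondCovOp.select h𝒳 (X ω))
      (CondCovOp.select h𝒳 (X ω))) μ)
    (hint₂ : Integrable (fun ω => CondCovOp.ker H₂ (Y ω) (Y ω)) μ) :
    IsSelfAdjoint (CondCovOp.condCov H₁ H₂ μ X Y) ∧
    IsSelfAdjoint (CondCovOp.condCov HT H₂ μ (fun ω => CondCovOp.select h𝒳 (X ω)) Y) ∧
    CondCovOp.condCov H₁ H₂ μ X Y ≤
      CondCovOp.condCov HT H₂ μ (fun ω => CondCovOp.select h𝒳 (X ω)) Y ∧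
    (∀ g : H₂, inner ℝ g (CondCovOp.condCov H₁ H₂ μ X Y g) ≤
      inner ℝ g (CondCovOp.condCov HT H₂ μ (fun ω => CondCovOp.select h𝒳 (X ω)) Y g)) ∧
    (CondCovOp.condCov H₁ H₂ μ X Y =
        CondCovOp.condCov HT H₂ μ (fun ω => CondCovOp.select h𝒳 (X ω)) Y ↔
      CondCovOp.CondIndepGiven μ Y X (fun ω => CondCovOp.select h𝒳 (X ω))) := by
  have hkT : Measurable fun p : CondCovOp.subDomain T 𝒳 × CondCovOp.subDomain T 𝒳 =>
      CondCovOp.ker HT p.1 p.2 := by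
    simp only [hHT]
    exact hk₁.comp (f := fun p : CondCovOp.subDomain T 𝒳 × CondCovOp.subDomain T 𝒳 =>
      (CondCovOp.embed p.1, CondCovOp.embed p.2))
      ((CondCovOp.measurable_embed.comp measurable_fst).prodMk
        (CondCovOp.measurable_embed.comp measurable_snd))
  have hsel := CondCovOp.measurable_select h𝒳
  have hZ : Measurable fun ω => CondCovOp.select h𝒳 (X ω) := hsel.comp hX
  have hcharT : CondCovOp.IsCharacteristic HT := hchar₁.of_leftInverse hk₁
    CondCovOp.measurable_embed hsel (CondCovOp.leftInverse_select_embed h𝒳) hHT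
  have hZX : MeasurableSpace.comap (fun ω => CondCovOp.select h𝒳 (X ω)) inferInstance ≤
      MeasurableSpace.comap X inferInstance :=
    (hsel.comp (comap_measurable X)).comap_le
  obtain ⟨J₁, hJ₁⟩ := CondCovOp.exists_isCenteredEmbedding (fun f => ((CondCovOp.measurable_apply
    (CondCovOp.measurable_ker_left hk₁) f).comp hX).aestronglyMeasurable) hint₁
  obtain ⟨JT, hJT⟩ := CondCovOp.exists_isCenteredEmbedding (fun f => ((CondCovOp.measurable_apply
    (CondCovOp.measurable_ker_left hkT) f).comp hZ).aestronglyMeasurable) hintT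
  obtain ⟨J₂, hJ₂⟩ := CondCovOp.exists_isCenteredEmbedding (fun f => ((CondCovOp.measurable_apply
    (CondCovOp.measurable_ker_left hk₂) f).comp hY).aestronglyMeasurable) hint₂
  have hM := hchar₁.mem_closure_range_iff hk₁ hX hint₁ hJ₁
  have hN := hcharT.mem_closure_range_iff hkT hZ hintT hJT
  have hNM : JT.range.topologicalClosure ≤ J₁.range.topologicalClosure := fun h hh =>
    (hM h).2 ⟨((hN h).1 hh).1.mono hZX, ((hN h).1 hh).2⟩
  rw [CondCovOp.condCov_eq hJ₁ hJ₂, CondCovOp.condCov_eq hJT hJ₂]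
  have hle := CondCovOp.adjoint_comp_one_sub_starProjection_le J₂ hNM
  refine ⟨CondCovOp.isSelfAdjoint_adjoint_comp_one_sub_starProjection J₂,
    CondCovOp.isSelfAdjoint_adjoint_comp_one_sub_starProjection J₂, hle, fun g => ?_, ?_⟩
  · rw [← sub_nonneg, ← inner_sub_right]
    exact ((ContinuousLinearMap.le_def _ _).1 hle).inner_nonneg_right g
  · rw [CondCovOp.adjoint_comp_one_sub_starProjection_eq_iff J₂ hNM]
    exact ⟨CondCovOp.condIndepGiven_of_starProjection_eq hchar₂ hk₂ hX hY hZ hZX hint₂ hJ₂ hM hN,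
      CondCovOp.starProjection_eq_of_condIndepGiven hk₂ hX hY hZ hNM hJ₂ hM hN⟩
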